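/- A tropical curve is the space $\Gamma$ obtained from a finite connected nonempty multigraph (loops allowed) with edge lengths $l(e)\in\mathbb R_{>0}\cup\{\infty\}$ by identifying each edge $e$ with $[0,l(e)]$, where $l(e)=\infty$ is allowed only if $e$ has an end of valence one, and the point $\infty\in[0,\infty]$ is then such an end. These points $\infty$ are the points at infinity, the other points are finite, and $\operatorname{dist}$ is the path distance. A rational function on $\Gamma$ is a continuous map $\Gamma\to\mathbb R\cup\{\pm\infty\}$ that is constant $-\infty$, or is piecewise affine with integer slopes and finitely many pieces and takes the values $\pm\infty$ only at points at infinity. The set $\operatorname{Rat}(\Gamma)$ of rational functions is a semiring with the operations $f\oplus g=\max\{f,g\}$ and $f\odot g=f+g$ on finite points, extended continuously to the points at infinity. For real $r>0$, an $r$-expansive map $\varphi:\Gamma_1\to\Gamma_2$ is a continuous bijection that restricts to a bijection between the finite points of $\Gamma_1$ and those of $\Gamma_2$ and satisfies $\operatorname{dist}(\varphi(x),\varphi(y))=r\cdot\operatorname{dist}(x,y)$ for all finite points $x,y$ of $\Gamma_1$. Consider the following two categories, both of which have the tropical curves as objects. In $\mathscr C$, the morphisms $\Gamma_1\to\Gamma_2$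 are the semiring isomorphisms $\operatorname{Rat}(\Gamma_1)\to\operatorname{Rat}(\Gamma_2)$. In $\mathscr D$, the morphisms $\Gamma_1\to\Gamma_2$ are the $r$-expansive maps $\Gamma_1\to\Gamma_2$ for all real $r>0$, where a morphism records its expansion factor $r$, that is, it is a pair $(r,\varphi)$ with $\varphi$ an $r$-expansive map, and $(s,\psi)\circ(r,\varphi)=(sr,\psi\circ\varphi)$. Then $\mathscr C$ and $\mathscr D$ are groupoids, and they are isomorphic, by functors $\mathscr C\to\mathscr D$ and $\mathscr D\to\mathscr C$ that are inverse to each other and are the identity on objects. If $\Gamma_1$ has more than one point, then the factor $r$ of a morphism $(r,\varphi):\Gamma_1\to\Gamma_2$ of $\mathscr D$ is determined by the map $\varphi$. -/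

import Mathlib

open scoped NNReal ENNReal Topology
universe u

/-- A finite, connected, nonempty multigraph (loops and multiple edges allowed). Every edge carries
a chosen direction, which only serves to fix the identification of the edge with an interval. -/
structure Multigraph where
  V : Type u
  E : Type u
  src : E → V
  tgt : E → V
  finite_V : Finite V
  finite_E : Finite E
  nonempty : Nonempty V
  connected : ∀ v w : V, Relation.EqvGen (fun a b => ∃ e, src e = a ∧ tgt e = b) v w

/-- The valence of a vertex: the number of incident edges, loops counted twice. -/
noncomputable def Multigraph.valence (G : Multigraph.{u}) (v : G.V) : ℕ :=
  {e | G.src e = v}.ncard + {e | G.tgt e = v}.ncard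

/-- A tropical curve, given by an edge-weighted graph with lengths in `(0, ∞]`. The edge `e` is
identified with `[0, len e]`, the source at `0` and the target at `len e`. An edge of infinite
length is a leaf edge, and its end at `∞` is a leaf end. -/
structure TropicalCurve extends Multigraph.{u} where
  len : E → ℝ≥0∞
  len_pos : ∀ e, 0 < len e
  leaf : ∀ e, len e = ⊤ → toMultigraph.valence (tgt e) = 1

namespace TropicalCurve

variable (Γ : TropicalCurve.{u})

/-- The closed interval `[0, len e]`, as a subspace of `[0, ∞]`. -/
abbrev Seg (e : Γ.E) : Type := Set.Icc (0 : ℝ≥0∞) (Γ.len e)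

/-- The disjoint union of the vertices and of the intervals `[0, len e]`. -/
abbrev PrePoint : Type u := Γ.V ⊕ (Σ e : Γ.E, Γ.Seg e)

/-- The vertices are isolated points before gluing. -/
instance : TopologicalSpace Γ.PrePoint :=
  @instTopologicalSpaceSum Γ.V (Σ e : Γ.E, Γ.Seg e) ⊥ inferInstance

/-- The end `0` of `[0, len e]` is glued to the source of `e`, the end `len e` to the target. -/
inductive Glue : Γ.PrePoint → Γ.PrePoint → Prop
  | src (e : Γ.E) : Glue (Sum.inr ⟨e, ⟨0, le_refl 0, zero_le⟩⟩) (Sum.inl (Γ.src e))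
  | tgt (e : Γ.E) : Glue (Sum.inr ⟨e, ⟨Γ.len e, zero_le, le_refl _⟩⟩) (Sum.inl (Γ.tgt e))

/-- The underlying topological space of the tropical curve. -/
def Point : Type u := Quot Γ.Glue

instance : TopologicalSpace Γ.Point := inferInstanceAs (TopologicalSpace (Quot Γ.Glue))

/-- The point with coordinate `t` on the edge `e`. -/
def edgePoint (e : Γ.E) (t : Γ.Seg e) : Γ.Point := Quot.mk _ (Sum.inr ⟨e, t⟩)

/-- The point given by a vertex. -/
def vertexPoint (v : Γ.V) : Γ.Point := Quot.mk _ (Sum.inl v)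

/-- The set of points at infinity. -/
def infinitePoints : Set Γ.Point :=
  {x | ∃ (e : Γ.E) (t : Γ.Seg e), (t : ℝ≥0∞) = ⊤ ∧ x = Γ.edgePoint e t}

/-- `IsPathLength x y L`: there is a path from `x` to `y` of length `L` that is a concatenation of
finitely many segments of edges. The length of the segment between the coordinates `s` and `t` is
`|s - t|`, written with truncated subtraction on `[0, ∞]`; it is infinite if exactly one of `s`, `t`
is `∞`. -/
inductive IsPathLength : Γ.Point → Γ.Point → ℝ≥0∞ → Prop
  | refl (x : Γ.Point) : IsPathLength x x 0
  | step (e : Γ.E) (s t : Γ.Seg e) (y : Γ.Point) (L : ℝ≥0∞)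
      (h : IsPathLength (Γ.edgePoint e t) y L) :
      IsPathLength (Γ.edgePoint e s) y
        (((s : ℝ≥0∞) - (t : ℝ≥0∞)) + ((t : ℝ≥0∞) - (s : ℝ≥0∞)) + L)

/-- The distance of two points: the infimum of the lengths of the paths between them. -/
noncomputable def dist (x y : Γ.Point) : ℝ≥0∞ := sInf {L | Γ.IsPathLength x y L}

/-- A function on an edge is piecewise affine with integer slopes and finitely many pieces: there
is a finite set `P` of breakpoints such that on every interval of finite points avoiding `P` the
function has the form `t ↦ c + k * t` with `c` real and `k` an integer. -/
def IsPiecewiseAffine {Γ : TropicalCurve.{u}} {e : Γ.E} (u : Γ.Seg e → EReal) : Prop :=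
  ∃ P : Finset (Γ.Seg e), ∀ I : Set (Γ.Seg e), I.OrdConnected →
    (∀ t ∈ I, t ∉ P ∧ (t : ℝ≥0∞) ≠ ⊤) →
    ∃ (k : ℤ) (c : ℝ), ∀ t ∈ I, u t = ((c + k * (t : ℝ≥0∞).toReal : ℝ) : EReal)

/-- A rational function: a continuous function to `[-∞, ∞]` that is constant `-∞`, or else is
piecewise affine with integer slopes and finitely many pieces and takes the values `-∞`, `∞` only
at points at infinity. -/
def IsRational (f : Γ.Point → EReal) : Prop :=
  Continuous f ∧
    ((∀ x, f x = ⊥) ∨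
      ((∀ x, x ∉ Γ.infinitePoints → f x ≠ ⊥ ∧ f x ≠ ⊤) ∧
        ∀ e : Γ.E, IsPiecewiseAffine (fun t : Γ.Seg e => f (Γ.edgePoint e t))))

/-- The set of rational functions on the tropical curve. -/
def RatFun : Type u := {f : Γ.Point → EReal // Γ.IsRational f}

variable {Γ}

/-! ### Facts about the space -/

theorem edgePoint_zero (e : Γ.E) :
    Γ.edgePoint e ⟨0, le_refl 0, zero_le⟩ = Γ.vertexPoint (Γ.src e) :=
  Quot.sound (Glue.src e)

theorem edgePoint_len (e : Γ.E) :
    Γ.edgePoint e ⟨Γ.len e, zero_le, le_refl _⟩ = Γ.vertexPoint (Γ.tgt e) :=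
  Quot.sound (Glue.tgt e)

theorem continuous_iff {Y : Type*} [TopologicalSpace Y] {f : Γ.Point → Y} :
    Continuous f ↔ ∀ e, Continuous (fun t : Γ.Seg e => f (Γ.edgePoint e t)) := by
  let _ : TopologicalSpace Γ.V := ⊥
  have : DiscreteTopology Γ.V := ⟨rfl⟩
  have h1 : Continuous f ↔ Continuous (fun p : Γ.PrePoint => f (Quot.mk _ p)) :=
    isQuotientMap_quot_mk.continuous_iff
  rw [h1]
  have h2 : Continuous (fun p : Γ.PrePoint => f (Quot.mk _ p)) ↔
      Continuous (fun v : Γ.V => f (Quot.mk _ (Sum.inl v))) ∧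
      Continuous (fun p : (Σ e : Γ.E, Γ.Seg e) => f (Quot.mk _ (Sum.inr p))) :=
    continuous_sum_dom
  rw [h2]
  constructor
  · rintro ⟨-, h⟩ e
    exact continuous_sigma_iff.1 h e
  · intro h
    exact ⟨continuous_of_discreteTopology, continuous_sigma_iff.2 h⟩

theorem continuous_edgePoint (e : Γ.E) : Continuous (Γ.edgePoint e) :=
  continuous_iff.1 continuous_id e

theorem src_ne_tgt {e e' : Γ.E} (h : Γ.len e = ⊤) : Γ.src e' ≠ Γ.tgt e := by
  intro h'
  have := Γ.finite_E
  have h1 := Γ.leaf e h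
  unfold Multigraph.valence at h1
  have h2 : 0 < {e'' | Γ.src e'' = Γ.tgt e}.ncard := (Set.ncard_pos (Set.toFinite _)).2 ⟨e', h'⟩
  have h3 : 0 < {e'' | Γ.tgt e'' = Γ.tgt e}.ncard := (Set.ncard_pos (Set.toFinite _)).2 ⟨e, rfl⟩
  omega

theorem eq_of_tgt_eq {e e' : Γ.E} (h : Γ.len e = ⊤) (h' : Γ.tgt e' = Γ.tgt e) : e' = e := by
  have := Γ.finite_E
  have h1 := Γ.leaf e h
  unfold Multigraph.valence at h1
  have h2 : {e'' | Γ.tgt e'' = Γ.tgt e}.ncard ≤ 1 := by omega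
  exact (Set.ncard_le_one (Set.toFinite _)).1 h2 e' h' e rfl

/-- On an infinite edge, `∞` is the only coordinate of the point at infinity. -/
theorem edgePoint_eq_top {e e' : Γ.E} {t : Γ.Seg e} {s : Γ.Seg e'} (ht : (t : ℝ≥0∞) = ⊤)
    (h : Γ.edgePoint e' s = Γ.edgePoint e t) : e' = e ∧ (s : ℝ≥0∞) = ⊤ := by
  have hl : Γ.len e = ⊤ := top_le_iff.1 (ht ▸ t.2.2)
  let Q : Γ.PrePoint → Prop := fun p =>
    Sum.elim (fun v => v = Γ.tgt e) (fun q => q.1 = e ∧ (q.2 : ℝ≥0∞) = ⊤) p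
  have hQ : ∀ a b, Γ.Glue a b → Q a = Q b := by
    rintro a b (e1 | e1)
    · simp [Q, src_ne_tgt hl]
    · apply propext
      simp only [Q, Sum.elim_inr, Sum.elim_inl]
      constructor
      · rintro ⟨rfl, -⟩
        rfl
      · intro h1
        obtain rfl := eq_of_tgt_eq hl h1
        exact ⟨rfl, hl⟩
  have := congrArg (Quot.lift Q hQ) h
  exact this.mpr ⟨rfl, ht⟩

theorem edgePoint_mem_infinitePoints {e : Γ.E} {t : Γ.Seg e} :
    Γ.edgePoint e t ∈ Γ.infinitePoints ↔ (t : ℝ≥0∞) = ⊤ := by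
  constructor
  · rintro ⟨e', t', ht', h⟩
    exact (edgePoint_eq_top ht' h).2
  · exact fun h => ⟨e, t, h, rfl⟩

/-- The point `∞` of an infinite edge is not isolated. -/
theorem neBot_nhdsNE {e : Γ.E} {t : Γ.Seg e} (ht : (t : ℝ≥0∞) = ⊤) : (𝓝[≠] t).NeBot := by
  have hl : Γ.len e = ⊤ := top_le_iff.1 (ht ▸ t.2.2)
  rw [← mem_closure_iff_nhdsWithin_neBot]
  let w : ℕ → Γ.Seg e := fun n => ⟨n, zero_le, hl ▸ le_top⟩
  refine mem_closure_of_tendsto (f := w) (b := Filter.atTop) ?_ (Filter.Eventually.of_forall ?_)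
  · rw [tendsto_subtype_rng, ht]
    exact ENNReal.tendsto_nat_nhds_top
  · intro n h
    have h1 : ((w n : Γ.Seg e) : ℝ≥0∞) = (t : ℝ≥0∞) := congrArg Subtype.val h
    rw [ht] at h1
    exact ENNReal.natCast_ne_top n h1

/-! ### Piecewise affine functions -/

theorem IsPiecewiseAffine.congr {e : Γ.E} {u v : Γ.Seg e → EReal} (hu : IsPiecewiseAffine u)
    (h : ∀ t : Γ.Seg e, (t : ℝ≥0∞) ≠ ⊤ → u t = v t) : IsPiecewiseAffine v := by
  obtain ⟨P, hP⟩ := hu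
  refine ⟨P, fun I hI hIP => ?_⟩
  obtain ⟨k, c, hkc⟩ := hP I hI hIP
  exact ⟨k, c, fun t ht => (h t (hIP t ht).2).symm.trans (hkc t ht)⟩

theorem isPiecewiseAffine_const {e : Γ.E} (a : ℝ) :
    IsPiecewiseAffine (fun _ : Γ.Seg e => (a : EReal)) :=
  ⟨∅, fun _ _ _ => ⟨0, a, fun _ _ => by simp⟩⟩

theorem IsPiecewiseAffine.add {e : Γ.E} {u v : Γ.Seg e → EReal} (hu : IsPiecewiseAffine u)
    (hv : IsPiecewiseAffine v) : IsPiecewiseAffine (fun t => u t + v t) := by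
  classical
  obtain ⟨P, hP⟩ := hu
  obtain ⟨Q, hQ⟩ := hv
  refine ⟨P ∪ Q, fun I hI hIP => ?_⟩
  simp only [Finset.mem_union, not_or] at hIP
  obtain ⟨k, c, h⟩ := hP I hI fun t ht => ⟨(hIP t ht).1.1, (hIP t ht).2⟩
  obtain ⟨m, d, h'⟩ := hQ I hI fun t ht => ⟨(hIP t ht).1.2, (hIP t ht).2⟩
  refine ⟨k + m, c + d, fun t ht => ?_⟩
  change u t + v t = _
  rw [h t ht, h' t ht, ← EReal.coe_add]
  congr 1
  push_cast
  ring

/-- The pieces of a piecewise affine function, labelled by the breakpoints to their left. -/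
theorem IsPiecewiseAffine.exists_pieces {e : Γ.E} {u : Γ.Seg e → EReal}
    (hu : IsPiecewiseAffine u) :
    ∃ (P : Finset (Γ.Seg e)) (k : Finset (Γ.Seg e) → ℤ) (c : Finset (Γ.Seg e) → ℝ),
      ∀ I : Set (Γ.Seg e), I.OrdConnected → (∀ t ∈ I, t ∉ P ∧ (t : ℝ≥0∞) ≠ ⊤) →
        ∃ A ∈ P.powerset, ∀ t ∈ I,
          u t = ((c A + k A * (t : ℝ≥0∞).toReal : ℝ) : EReal) := by
  classical
  obtain ⟨P, hP⟩ := hu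
  let J : Finset (Γ.Seg e) → Set (Γ.Seg e) := fun A =>
    {t | t ∉ P ∧ (t : ℝ≥0∞) ≠ ⊤ ∧ ∀ p ∈ P, p < t ↔ p ∈ A}
  have hJ : ∀ A, (J A).OrdConnected := by
    intro A
    refine ⟨fun s hs t ht x hx => ⟨fun hxP => ?_, ?_, fun p hp => ⟨fun h => ?_, fun h => ?_⟩⟩⟩
    · have h1 : x < t := lt_of_le_of_ne hx.2 (fun h => ht.1 (h ▸ hxP))
      have h2 : x < s := (hs.2.2 x hxP).2 ((ht.2.2 x hxP).1 h1)
      exact absurd hx.1 (not_le.2 h2)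
    · exact ne_top_of_le_ne_top ht.2.1 hx.2
    · exact (ht.2.2 p hp).1 (lt_of_lt_of_le h hx.2)
    · exact lt_of_lt_of_le ((hs.2.2 p hp).2 h) hx.1
  have key : ∀ A, ∃ (k : ℤ) (c : ℝ), ∀ t ∈ J A,
      u t = ((c + k * (t : ℝ≥0∞).toReal : ℝ) : EReal) := fun A =>
    hP (J A) (hJ A) fun t ht => ⟨ht.1, ht.2.1⟩
  choose k c hkc using key
  refine ⟨P, k, c, fun I hI hIP => ?_⟩
  rcases I.eq_empty_or_nonempty with rfl | ⟨s, hs⟩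
  · exact ⟨∅, by simp, by simp⟩
  refine ⟨P.filter (· < s), by simp, fun t ht => hkc _ t ⟨(hIP t ht).1, (hIP t ht).2, ?_⟩⟩
  intro p hp
  simp only [Finset.mem_filter, hp, true_and]
  constructor
  · intro h
    by_contra h'
    exact (hIP p (hI.out hs ht ⟨not_lt.1 h', h.le⟩)).1 hp
  · intro h
    by_contra h'
    exact (hIP p (hI.out ht hs ⟨not_lt.1 h', h.le⟩)).1 hp

theorem IsPiecewiseAffine.sup {e : Γ.E} {u v : Γ.Seg e → EReal} (hu : IsPiecewiseAffine u)
    (hv : IsPiecewiseAffine v) : IsPiecewiseAffine (fun t => max (u t) (v t)) := by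
  classical
  obtain ⟨P, k, c, hP⟩ := hu.exists_pieces
  obtain ⟨Q, m, d, hQ⟩ := hv.exists_pieces
  -- the point where two of the affine functions cross, if it lies on the edge
  let z : Finset (Γ.Seg e) × Finset (Γ.Seg e) → ℝ≥0∞ := fun A =>
    ENNReal.ofReal ((d A.2 - c A.1) / (k A.1 - m A.2))
  let Z : Finset (Γ.Seg e) := (P.powerset ×ˢ Q.powerset).image
    fun A => if h : z A ≤ Γ.len e then ⟨z A, zero_le, h⟩ else ⟨0, le_refl 0, zero_le⟩
  refine ⟨P ∪ Q ∪ Z, fun I hI hIP => ?_⟩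
  simp only [Finset.mem_union, not_or] at hIP
  obtain ⟨A, hA, hu'⟩ := hP I hI fun t ht => ⟨(hIP t ht).1.1.1, (hIP t ht).2⟩
  obtain ⟨B, hB, hv'⟩ := hQ I hI fun t ht => ⟨(hIP t ht).1.1.2, (hIP t ht).2⟩
  have cross : ∀ x ∈ I, c A + k A * (x : ℝ≥0∞).toReal = d B + m B * (x : ℝ≥0∞).toReal →
      (k A : ℝ) = m B := by
    intro x hx h
    by_contra hne
    have hne' : (k A : ℝ) - m B ≠ 0 := sub_ne_zero.2 hne
    apply (hIP x hx).1.2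
    have hz : z (A, B) = x := by
      have : (d B - c A) / (k A - m B) = (x : ℝ≥0∞).toReal := by
        rw [div_eq_iff hne']
        linarith
      simp only [z, this, ENNReal.ofReal_toReal (hIP x hx).2]
    refine Finset.mem_image.2 ⟨(A, B), Finset.mem_product.2 ⟨hA, hB⟩, ?_⟩
    rw [dif_pos (hz ▸ x.2.2)]
    exact Subtype.ext hz
  by_cases hall : ∀ t ∈ I, c A + k A * (t : ℝ≥0∞).toReal ≤ d B + m B * (t : ℝ≥0∞).toReal
  · refine ⟨m B, d B, fun t ht => ?_⟩
    simp only [hu' t ht, hv' t ht]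
    exact max_eq_right (EReal.coe_le_coe_iff.2 (hall t ht))
  · push Not at hall
    obtain ⟨s, hs, hlt⟩ := hall
    refine ⟨k A, c A, fun t ht => ?_⟩
    simp only [hu' t ht, hv' t ht]
    refine max_eq_left (EReal.coe_le_coe_iff.2 ?_)
    by_contra hcon
    push Not at hcon
    have hs' := (hIP s hs).2
    have ht' := (hIP t ht).2
    -- the crossing point lies between `s` and `t`
    set a := (s : ℝ≥0∞).toReal with ha
    set b := (t : ℝ≥0∞).toReal with hb
    have hne : (k A : ℝ) - m B ≠ 0 := by
      intro h0
      have h1 : (k A : ℝ) = m B := by linarith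
      rw [h1] at hlt hcon
      linarith
    set y := (d B - c A) / ((k A : ℝ) - m B) with hy
    have hyeq : c A + k A * y = d B + m B * y := by
      have : y * ((k A : ℝ) - m B) = d B - c A := div_mul_cancel₀ _ hne
      linarith
    have hbetw : (a ≤ y ∧ y ≤ b) ∨ (b ≤ y ∧ y ≤ a) := by
      have e1 : 0 < ((k A : ℝ) - m B) * (a - y) := by nlinarith
      have e2 : ((k A : ℝ) - m B) * (b - y) < 0 := by nlinarith
      rcases lt_or_gt_of_ne hne with h | h
      · left
        constructor <;> nlinarith
      · right
        constructor <;> nlinarith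
    have ha0 : 0 ≤ a := ENNReal.toReal_nonneg
    have hb0 : 0 ≤ b := ENNReal.toReal_nonneg
    have hy0 : 0 ≤ y := by rcases hbetw with h | h <;> linarith
    have hsa : (s : ℝ≥0∞) = ENNReal.ofReal a := (ENNReal.ofReal_toReal hs').symm
    have htb : (t : ℝ≥0∞) = ENNReal.ofReal b := (ENNReal.ofReal_toReal ht').symm
    have hylen : ENNReal.ofReal y ≤ Γ.len e := by
      rcases hbetw with h | h
      · exact (ENNReal.ofReal_le_ofReal h.2).trans (htb ▸ t.2.2)
      · exact (ENNReal.ofReal_le_ofReal h.2).trans (hsa ▸ s.2.2)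
    let x : Γ.Seg e := ⟨ENNReal.ofReal y, zero_le, hylen⟩
    have hxI : x ∈ I := by
      rcases hbetw with h | h
      · refine hI.out hs ht ⟨?_, ?_⟩
        · exact Subtype.coe_le_coe.1 (hsa.trans_le (ENNReal.ofReal_le_ofReal h.1))
        · exact Subtype.coe_le_coe.1 ((ENNReal.ofReal_le_ofReal h.2).trans_eq htb.symm)
      · refine hI.out ht hs ⟨?_, ?_⟩
        · exact Subtype.coe_le_coe.1 (htb.trans_le (ENNReal.ofReal_le_ofReal h.1))
        · exact Subtype.coe_le_coe.1 ((ENNReal.ofReal_le_ofReal h.2).trans_eq hsa.symm)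
    have hxy : (x : ℝ≥0∞).toReal = y := ENNReal.toReal_ofReal hy0
    exact hne (sub_eq_zero.2 (cross x hxI (by rw [hxy]; exact hyeq)))

/-- A piecewise affine function has a limit in `[-∞, ∞]` at the end `∞` of an infinite edge. -/
theorem IsPiecewiseAffine.exists_limit {e : Γ.E} {u : Γ.Seg e → EReal} (hu : IsPiecewiseAffine u)
    {t : Γ.Seg e} (ht : (t : ℝ≥0∞) = ⊤) : ∃ y, Filter.Tendsto u (𝓝[≠] t) (𝓝 y) := by
  classical
  obtain ⟨P, hP⟩ := hu
  have hmax : ∀ s : Γ.Seg e, s ≤ t := fun s =>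
    Subtype.coe_le_coe.1 (ht ▸ le_top)
  have htop : ∀ s : Γ.Seg e, (s : ℝ≥0∞) = ⊤ ↔ s = t := fun s =>
    ⟨fun h => Subtype.ext (h.trans ht.symm), fun h => h ▸ ht⟩
  let I : Set (Γ.Seg e) := {s | s ≠ t ∧ ∀ p ∈ P, p ≠ t → p < s}
  have hI : I.OrdConnected := by
    refine ⟨fun a ha b hb x hx => ⟨fun h => ?_, fun p hp hpt => (ha.2 p hp hpt).trans_le hx.1⟩⟩
    exact hb.1 (le_antisymm (hmax b) (h ▸ hx.2))
  have hIn : I ∈ 𝓝[≠] t := by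
    have h1 : ∀ᶠ s in 𝓝 t, ∀ p ∈ P, p ≠ t → p < s := by
      rw [Filter.eventually_all_finset]
      intro p _
      by_cases hpt : p = t
      · simp [hpt]
      · have : p < t := lt_of_le_of_ne (hmax p) hpt
        exact (lt_mem_nhds this).mono fun s hs _ => hs
    filter_upwards [nhdsWithin_le_nhds h1, self_mem_nhdsWithin] with s hs hst
    exact ⟨hst, hs⟩
  obtain ⟨k, c, hkc⟩ := hP I hI fun s hs =>
    ⟨fun hsP => lt_irrefl _ (hs.2 s hsP hs.1), fun h => hs.1 ((htop s).1 h)⟩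
  have hreal : Filter.Tendsto (fun s : Γ.Seg e => (s : ℝ≥0∞).toReal) (𝓝[≠] t) Filter.atTop := by
    rw [Filter.tendsto_atTop]
    intro b
    have h1 : Filter.Tendsto (fun s : Γ.Seg e => (s : ℝ≥0∞)) (𝓝 t) (𝓝 ⊤) := by
      rw [← ht]
      exact continuous_subtype_val.tendsto t
    have h2 : ∀ᶠ s : Γ.Seg e in 𝓝 t, ENNReal.ofReal b < (s : ℝ≥0∞) :=
      h1.eventually (lt_mem_nhds ENNReal.ofReal_lt_top)
    filter_upwards [nhdsWithin_le_nhds h2, self_mem_nhdsWithin] with s hs hst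
    have hs' : (s : ℝ≥0∞) ≠ ⊤ := fun h => hst ((htop s).1 h)
    exact (ENNReal.ofReal_le_iff_le_toReal hs').1 hs.le
  have hev : (fun s : Γ.Seg e => ((c + k * (s : ℝ≥0∞).toReal : ℝ) : EReal)) =ᶠ[𝓝[≠] t] u :=
    Filter.mem_of_superset hIn fun s hs => (hkc s hs).symm
  rcases lt_trichotomy k 0 with hk | hk | hk
  · refine ⟨⊥, Filter.Tendsto.congr' hev ?_⟩
    have hk' : (k : ℝ) < 0 := by exact_mod_cast hk
    exact EReal.tendsto_coe_nhds_bot_iff.2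
      (Filter.tendsto_atBot_add_const_left _ c (hreal.const_mul_atTop_of_neg hk'))
  · refine ⟨(c : EReal), Filter.Tendsto.congr' hev ?_⟩
    simpa [hk] using tendsto_const_nhds
  · refine ⟨⊤, Filter.Tendsto.congr' hev ?_⟩
    have hk' : (0 : ℝ) < k := by exact_mod_cast hk
    exact EReal.tendsto_coe_nhds_top_iff.2
      (Filter.tendsto_atTop_add_const_left _ c (hreal.const_mul_atTop hk'))

/-! ### The semiring of rational functions -/

namespace RatFun

instance : CoeFun Γ.RatFun (fun _ => Γ.Point → EReal) := ⟨Subtype.val⟩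

/-- Rational functions that agree at all finite points are equal. -/
theorem ext_finite {f g : Γ.RatFun} (h : ∀ x, x ∉ Γ.infinitePoints → f x = g x) : f = g := by
  apply Subtype.ext
  funext x
  by_cases hx : x ∈ Γ.infinitePoints
  · obtain ⟨e, t, ht, rfl⟩ := hx
    have := neBot_nhdsNE ht
    have hf := ((f.2.1.comp (continuous_edgePoint e)).tendsto t).mono_left
      (nhdsWithin_le_nhds (s := {t}ᶜ))
    have hg := ((g.2.1.comp (continuous_edgePoint e)).tendsto t).mono_left
      (nhdsWithin_le_nhds (s := {t}ᶜ))
    refine tendsto_nhds_unique_of_eventuallyEq hf hg ?_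
    filter_upwards [self_mem_nhdsWithin] with s hs
    refine h _ fun hmem => hs ?_
    exact Subtype.ext ((edgePoint_mem_infinitePoints.1 hmem).trans ht.symm)
  · exact h x hx

theorem isRational_const (a : ℝ) : Γ.IsRational (fun _ => (a : EReal)) :=
  ⟨continuous_const, Or.inr ⟨fun _ _ => ⟨EReal.coe_ne_bot a, EReal.coe_ne_top a⟩,
    fun _ => isPiecewiseAffine_const a⟩⟩

theorem isRational_sup {f g : Γ.Point → EReal} (hf : Γ.IsRational f) (hg : Γ.IsRational g) :
    Γ.IsRational (fun x => max (f x) (g x)) := by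
  refine ⟨hf.1.max hg.1, ?_⟩
  rcases hf.2 with hf' | hf'
  · have : (fun x => max (f x) (g x)) = g := by
      funext x
      simp [hf' x]
    rw [this]
    exact hg.2
  rcases hg.2 with hg' | hg'
  · have : (fun x => max (f x) (g x)) = f := by
      funext x
      simp [hg' x]
    rw [this]
    exact hf.2
  refine Or.inr ⟨fun x hx => ?_, fun e => (hf'.2 e).sup (hg'.2 e)⟩
  change max (f x) (g x) ≠ ⊥ ∧ max (f x) (g x) ≠ ⊤
  rcases max_choice (f x) (g x) with h | h <;> rw [h]
  · exact hf'.1 x hx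
  · exact hg'.1 x hx

/-- The pointwise sum of two rational functions on the finite points extends to a rational
function. -/
theorem exists_mul (f g : Γ.RatFun) :
    ∃ h : Γ.RatFun, ∀ x, x ∉ Γ.infinitePoints → h x = f x + g x := by
  classical
  rcases f.2.2 with hf | hf
  · refine ⟨f, fun x _ => ?_⟩
    rw [hf x, EReal.bot_add]
  rcases g.2.2 with hg | hg
  · refine ⟨g, fun x _ => ?_⟩
    rw [hg x, EReal.add_bot]
  have hPA : ∀ e : Γ.E, IsPiecewiseAffine
      (fun t : Γ.Seg e => f (Γ.edgePoint e t) + g (Γ.edgePoint e t)) := fun e =>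
    (hf.2 e).add (hg.2 e)
  have hlim : ∀ x : Γ.Point, ∃ y : EReal, (x ∉ Γ.infinitePoints → y = f x + g x) ∧
      ∀ (e : Γ.E) (t : Γ.Seg e), (t : ℝ≥0∞) = ⊤ → x = Γ.edgePoint e t →
        Filter.Tendsto (fun s => f (Γ.edgePoint e s) + g (Γ.edgePoint e s)) (𝓝[≠] t) (𝓝 y) := by
    intro x
    by_cases hx : x ∈ Γ.infinitePoints
    · obtain ⟨e, t, ht, rfl⟩ := hx
      obtain ⟨y, hy⟩ := (hPA e).exists_limit ht
      refine ⟨y, fun h => absurd ⟨e, t, ht, rfl⟩ h, fun e' t' ht' h => ?_⟩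
      obtain ⟨rfl, -⟩ := edgePoint_eq_top ht' h
      obtain rfl : t = t' := Subtype.ext (ht.trans ht'.symm)
      exact hy
    · exact ⟨_, fun _ => rfl, fun e t ht h => absurd ⟨e, t, ht, h⟩ hx⟩
  choose h hfin hinf using hlim
  have hval : ∀ (e : Γ.E) (t : Γ.Seg e), (t : ℝ≥0∞) ≠ ⊤ →
      f (Γ.edgePoint e t) + g (Γ.edgePoint e t) = h (Γ.edgePoint e t) := fun e t ht =>
    (hfin _ fun hm => ht (edgePoint_mem_infinitePoints.1 hm)).symm
  refine ⟨⟨h, continuous_iff.2 fun e => continuous_iff_continuousAt.2 fun t => ?_,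
    Or.inr ⟨fun x hx => ?_, fun e => (hPA e).congr (hval e)⟩⟩, hfin⟩
  · by_cases ht : (t : ℝ≥0∞) = ⊤
    · have h1 := hinf _ e t ht rfl
      rw [continuousAt_iff_punctured_nhds]
      refine h1.congr' ?_
      filter_upwards [self_mem_nhdsWithin] with s hs
      exact hval e s fun hs' => hs (Subtype.ext (hs'.trans ht.symm))
    · have hx : Γ.edgePoint e t ∉ Γ.infinitePoints := fun hm =>
        ht (edgePoint_mem_infinitePoints.1 hm)
      have hfc : ContinuousAt (fun s => f (Γ.edgePoint e s)) t :=
        (f.2.1.comp (continuous_edgePoint e)).continuousAt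
      have hgc : ContinuousAt (fun s => g (Γ.edgePoint e s)) t :=
        (g.2.1.comp (continuous_edgePoint e)).continuousAt
      have hadd : ContinuousAt (fun s => f (Γ.edgePoint e s) + g (Γ.edgePoint e s)) t :=
        ContinuousAt.comp (f := fun s => (f (Γ.edgePoint e s), g (Γ.edgePoint e s)))
          (EReal.continuousAt_add (Or.inl (hf.1 _ hx).2) (Or.inl (hf.1 _ hx).1))
          (hfc.prodMk hgc)
      refine hadd.congr ?_
      have hopen : ∀ᶠ s : Γ.Seg e in 𝓝 t, (s : ℝ≥0∞) ≠ ⊤ :=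
        (continuous_subtype_val.tendsto t).eventually (isOpen_ne.mem_nhds ht)
      filter_upwards [hopen] with s hs
      exact hval e s hs
  · rw [hfin x hx]
    have h1 := hf.1 x hx
    have h2 := hg.1 x hx
    lift f x to ℝ using ⟨h1.2, h1.1⟩ with a
    lift g x to ℝ using ⟨h2.2, h2.1⟩ with b
    rw [← EReal.coe_add]
    exact ⟨EReal.coe_ne_bot _, EReal.coe_ne_top _⟩

/-- The sum of rational functions is the pointwise maximum. -/
noncomputable instance : Add Γ.RatFun :=
  ⟨fun f g => ⟨fun x => max (f x) (g x), isRational_sup f.2 g.2⟩⟩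

/-- The product of rational functions is the pointwise sum at the finite points, extended
continuously to the points at infinity. -/
noncomputable instance : Mul Γ.RatFun := ⟨fun f g => Classical.choose (exists_mul f g)⟩

/-- The zero element is the constant function `-∞`. -/
noncomputable instance : Zero Γ.RatFun :=
  ⟨⟨fun _ => ⊥, continuous_const, Or.inl fun _ => rfl⟩⟩

/-- The unit element is the constant function `0`. -/
noncomputable instance : One Γ.RatFun := ⟨⟨fun _ => ((0 : ℝ) : EReal), isRational_const 0⟩⟩

theorem add_apply (f g : Γ.RatFun) (x : Γ.Point) : (f + g) x = max (f x) (g x) := rfl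

theorem mul_apply (f g : Γ.RatFun) {x : Γ.Point} (hx : x ∉ Γ.infinitePoints) :
    (f * g) x = f x + g x := Classical.choose_spec (exists_mul f g) x hx

theorem zero_apply (x : Γ.Point) : (0 : Γ.RatFun) x = ⊥ := rfl

theorem one_apply (x : Γ.Point) : (1 : Γ.RatFun) x = 0 := rfl

theorem ereal_add_max (a b c : EReal) : a + max b c = max (a + b) (a + c) :=
  Monotone.map_max (f := fun y => a + y) fun _ _ h => add_le_add_right h a

noncomputable instance : CommSemiring Γ.RatFun where
  add_assoc f g h := ext_finite fun x _ => max_assoc (f x) (g x) (h x)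
  zero_add f := ext_finite fun x _ => bot_sup_eq (f x)
  add_zero f := ext_finite fun x _ => sup_bot_eq (f x)
  add_comm f g := ext_finite fun x _ => max_comm (f x) (g x)
  nsmul := nsmulRec
  left_distrib f g h := ext_finite fun x hx => by
    simp only [mul_apply _ _ hx, add_apply, ereal_add_max]
  right_distrib f g h := ext_finite fun x hx => by
    simp only [mul_apply _ _ hx, add_apply, add_comm _ (h x), ereal_add_max]
  zero_mul f := ext_finite fun x hx => by
    simp only [mul_apply _ _ hx, zero_apply, EReal.bot_add]
  mul_zero f := ext_finite fun x hx => by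
    simp only [mul_apply _ _ hx, zero_apply, EReal.add_bot]
  mul_assoc f g h := ext_finite fun x hx => by
    simp only [mul_apply _ _ hx, add_assoc]
  one_mul f := ext_finite fun x hx => by
    simp only [mul_apply _ _ hx, one_apply, zero_add]
  mul_one f := ext_finite fun x hx => by
    simp only [mul_apply _ _ hx, one_apply, add_zero]
  mul_comm f g := ext_finite fun x hx => by
    simp only [mul_apply _ _ hx, add_comm (f x)]

end RatFun

/-! ### Expansive maps -/

/-- `φ` is an `r`-expansive map: a continuous bijection that restricts to a bijection of the finite
points under which all distances are multiplied by `r`. -/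
structure IsExpansive {Γ₁ Γ₂ : TropicalCurve.{u}} (r : ℝ≥0) (φ : Γ₁.Point → Γ₂.Point) : Prop where
  continuous : Continuous φ
  bijective : Function.Bijective φ
  mem_infinitePoints : ∀ x, φ x ∈ Γ₂.infinitePoints ↔ x ∈ Γ₁.infinitePoints
  dist_eq : ∀ x y, x ∉ Γ₁.infinitePoints → y ∉ Γ₁.infinitePoints →
    (r : ℝ≥0∞) * Γ₁.dist x y = Γ₂.dist (φ x) (φ y)

/-- An `r`-expansive map for some real number `r > 0`, together with its expansion factor `r`. -/
@[ext]
structure ExpansiveMap (Γ₁ Γ₂ : TropicalCurve.{u}) where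
  factor : ℝ≥0
  toFun : Γ₁.Point → Γ₂.Point
  factor_pos : 0 < factor
  isExpansive : IsExpansive factor toFun

/-- The identity map, with expansion factor `1`. -/
def ExpansiveMap.id (Γ : TropicalCurve.{u}) : ExpansiveMap Γ Γ where
  factor := 1
  toFun x := x
  factor_pos := one_pos
  isExpansive :=
    { continuous := continuous_id
      bijective := Function.bijective_id
      mem_infinitePoints := fun _ => Iff.rfl
      dist_eq := fun x y _ _ => by simp }

/-- The composition `ψ ∘ φ`; the expansion factors are multiplied. -/
def ExpansiveMap.comp {Γ₁ Γ₂ Γ₃ : TropicalCurve.{u}} (ψ : ExpansiveMap Γ₂ Γ₃)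
    (φ : ExpansiveMap Γ₁ Γ₂) : ExpansiveMap Γ₁ Γ₃ where
  factor := ψ.factor * φ.factor
  toFun x := ψ.toFun (φ.toFun x)
  factor_pos := mul_pos ψ.factor_pos φ.factor_pos
  isExpansive :=
    { continuous := ψ.isExpansive.continuous.comp φ.isExpansive.continuous
      bijective := ψ.isExpansive.bijective.comp φ.isExpansive.bijective
      mem_infinitePoints := fun x =>
        (ψ.isExpansive.mem_infinitePoints _).trans (φ.isExpansive.mem_infinitePoints x)
      dist_eq := fun x y hx hy => by
        rw [← ψ.isExpansive.dist_eq _ _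
            (fun h => hx ((φ.isExpansive.mem_infinitePoints x).1 h))
            (fun h => hy ((φ.isExpansive.mem_infinitePoints y).1 h)),
          ← φ.isExpansive.dist_eq x y hx hy, ENNReal.coe_mul, mul_assoc] }

end TropicalCurve

/-! ### The two categories -/

/-- The objects of the category of tropical curves and semiring isomorphisms between their
semifields of rational functions. -/
structure RatCat where
  curve : TropicalCurve.{u}

noncomputable instance : CategoryTheory.Category RatCat.{u} where
  Hom X Y := X.curve.RatFun ≃+* Y.curve.RatFun
  id X := RingEquiv.refl X.curve.RatFun
  comp φ ψ := φ.trans ψ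

/-- The objects of the category of tropical curves and expansive maps. -/
structure ExpCat where
  curve : TropicalCurve.{u}

instance : CategoryTheory.Category ExpCat.{u} where
  Hom X Y := TropicalCurve.ExpansiveMap X.curve Y.curve
  id X := TropicalCurve.ExpansiveMap.id X.curve
  comp φ ψ := ψ.comp φ
  id_comp _ := TropicalCurve.ExpansiveMap.ext (mul_one _) rfl
  comp_id _ := TropicalCurve.ExpansiveMap.ext (one_mul _) rfl
  assoc _ _ _ := TropicalCurve.ExpansiveMap.ext (mul_assoc _ _ _).symm rfl

/-! The two categories are linked by the relation `IsInduced φ r Ψ`: `φ f (Ψ x) = r * f x` for all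
`f` and `x`, with `r > 0`. Every semiring isomorphism is induced by exactly one pair `(r, Ψ)`, this
`Ψ` is `r`-expansive, and every `r`-expansive map induces exactly one isomorphism. The relation
respects identities and composition, so both passages are functors, and uniqueness makes them
inverse to each other.

The factor: since slopes are integers, a nonzero rational function is constant if and only if it has
roots of every order `n ≥ 1` (`eq_const_of_divisible`). So an isomorphism preserves the real
constants. On these it respects sum and maximum, hence it is multiplication by some `r > 0`
(`exists_factor`).

The map on points: for `y` in `Γ₂`, the functional `f ↦ φ f y` is `r` times the evaluation at some
point (`exists_point`). Otherwise every point `x` admits `g` with `φ g y ≤ 0 < g x`. By compactness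
a finite maximum of such functions is positive everywhere, hence at least some real `ε > 0`, and
then `φ g y ≥ r * ε > 0`. Rational functions separate points (`separates`), so the point is unique.
By compactness they also induce the topology, so `Ψ` is continuous. The points at infinity are those
at which some nonzero rational function is `∞`.

The distances: let `φ f` be the distance from `Ψ y`, with slopes at most `1` in absolute value. To
bound a slope `k` of `f`, compare `f` with the distance `T` from a nearby point. Locally `f` is a
constant plus `± k * T`, so `φ f` has slope `± k * m`, where `m` is the slope of `φ T`, a nonzero
integer. Hence `|k| ≤ 1` (`abs_slope_le_one`), so `f` is `1`-Lipschitz and `Ψ` stretches distances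
at most by `r` (`dist_le`). The inverse isomorphism gives the opposite inequality.

Conversely, an expansive map is a homeomorphism which, in edge coordinates near all but finitely
many points, is affine with slope `± r`. Therefore `r • f ∘ Ψ⁻¹` again has integer slopes. -/

namespace TropicalCurve

/-! ### Distances in `[0, ∞]` -/

/-- The distance of two elements of `[0, ∞]`, with `gap ∞ ∞ = 0`. -/
noncomputable def gap (s t : ℝ≥0∞) : ℝ≥0∞ := (s - t) + (t - s)

theorem gap_self (s : ℝ≥0∞) : gap s s = 0 := by simp [gap]

theorem gap_comm (s t : ℝ≥0∞) : gap s t = gap t s := add_comm _ _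

theorem gap_of_le {s t : ℝ≥0∞} (h : s ≤ t) : gap s t = t - s := by
  simp [gap, tsub_eq_zero_of_le h]

theorem gap_triangle (s t u : ℝ≥0∞) : gap s u ≤ gap s t + gap t u := by
  calc (s - u) + (u - s) ≤ ((s - t) + (t - u)) + ((u - t) + (t - s)) :=
        add_le_add tsub_le_tsub_add_tsub tsub_le_tsub_add_tsub
    _ = gap s t + gap t u := by unfold gap; ring

theorem gap_top {s : ℝ≥0∞} (h : s ≠ ⊤) : gap ⊤ s = ⊤ := by simp [gap, ENNReal.top_sub h]

theorem gap_eq_ofReal {s t : ℝ≥0∞} (hs : s ≠ ⊤) (ht : t ≠ ⊤) :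
    gap s t = ENNReal.ofReal |s.toReal - t.toReal| := by
  rcases le_total s t with h | h
  · rw [gap_of_le h, abs_sub_comm, abs_of_nonneg (sub_nonneg.2 (ENNReal.toReal_mono ht h)),
      ENNReal.ofReal_sub _ ENNReal.toReal_nonneg, ENNReal.ofReal_toReal hs,
      ENNReal.ofReal_toReal ht]
  · rw [gap_comm, gap_of_le h, abs_of_nonneg (sub_nonneg.2 (ENNReal.toReal_mono hs h)),
      ENNReal.ofReal_sub _ ENNReal.toReal_nonneg, ENNReal.ofReal_toReal hs,
      ENNReal.ofReal_toReal ht]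

theorem toReal_gap {s t : ℝ≥0∞} (hs : s ≠ ⊤) (ht : t ≠ ⊤) :
    (gap s t).toReal = |s.toReal - t.toReal| := by
  rw [gap_eq_ofReal hs ht, ENNReal.toReal_ofReal (abs_nonneg _)]

theorem gap_ne_top {s t : ℝ≥0∞} (hs : s ≠ ⊤) (ht : t ≠ ⊤) : gap s t ≠ ⊤ := by
  rw [gap_eq_ofReal hs ht]
  exact ENNReal.ofReal_ne_top

theorem eq_of_gap_eq_zero {s t : ℝ≥0∞} (h : gap s t = 0) : s = t := by
  rw [gap, add_eq_zero, tsub_eq_zero_iff_le, tsub_eq_zero_iff_le] at h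
  exact le_antisymm h.1 h.2

/-- This and `sub_le_gap_add_sub` express that the distances to the two ends of an edge are
`1`-Lipschitz in the coordinate, in a form that makes sense at `∞`. -/
theorem le_gap_add (s t : ℝ≥0∞) : s ≤ gap s t + t := by
  calc s ≤ (s - t) + t := le_tsub_add
    _ ≤ gap s t + t := by gcongr; exact le_self_add

theorem sub_le_gap_add_sub (l s t : ℝ≥0∞) : l - s ≤ gap s t + (l - t) := by
  calc l - s ≤ (l - t) + (t - s) := tsub_le_tsub_add_tsub
    _ ≤ (l - t) + gap s t := by gcongr; exact le_add_self
    _ = _ := add_comm _ _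

/-- Finiteness of `s` matters: `gap t ∞` jumps from `∞` at finite `t` to `0` at `t = ∞`. -/
theorem continuous_gap {s : ℝ≥0∞} (hs : s ≠ ⊤) : Continuous fun t => gap t s :=
  (ENNReal.continuous_sub_right s).add (ENNReal.continuous_sub_left hs)

variable {Γ : TropicalCurve.{u}}

/-! ### Points of a tropical curve -/

/-- The coordinate of the source of an edge. -/
abbrev Seg.first (e : Γ.E) : Γ.Seg e := ⟨0, le_refl 0, zero_le⟩

/-- The coordinate of the target of an edge. -/
abbrev Seg.last (e : Γ.E) : Γ.Seg e := ⟨Γ.len e, zero_le, le_refl _⟩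

/-- The coordinates of points that are not ends of the edge. -/
def Seg.IsInner {e : Γ.E} (t : Γ.Seg e) : Prop := 0 < (t : ℝ≥0∞) ∧ (t : ℝ≥0∞) < Γ.len e

theorem Seg.IsInner.ne_top {e : Γ.E} {t : Γ.Seg e} (h : t.IsInner) : (t : ℝ≥0∞) ≠ ⊤ := h.2.ne_top

theorem Seg.eq_ends_of_not_isInner {e : Γ.E} {t : Γ.Seg e} (h : ¬ t.IsInner) :
    t = Seg.first e ∨ t = Seg.last e := by
  by_contra hc
  push Not at hc
  refine h ⟨pos_iff_ne_zero.2 fun h0 => hc.1 (Subtype.ext h0), ?_⟩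
  exact lt_of_le_of_ne t.2.2 fun h0 => hc.2 (Subtype.ext h0)

theorem Seg.not_isInner_first (e : Γ.E) : ¬ (Seg.first e).IsInner := fun h => lt_irrefl _ h.1

theorem Seg.not_isInner_last (e : Γ.E) : ¬ (Seg.last e).IsInner := fun h => lt_irrefl _ h.2

theorem Seg.eventually_isInner {e : Γ.E} {t : Γ.Seg e} (h : t.IsInner) :
    ∀ᶠ s in 𝓝 t, s.IsInner :=
  (continuous_subtype_val.tendsto t).eventually (Ioo_mem_nhds h.1 h.2)

theorem Seg.finite_not_isInner (e : Γ.E) : {t : Γ.Seg e | ¬ t.IsInner}.Finite :=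
  (Set.toFinite {Seg.first e, Seg.last e}).subset fun _ ht => Seg.eq_ends_of_not_isInner ht

instance (e : Γ.E) : Nontrivial (Γ.Seg e) :=
  ⟨Seg.first e, Seg.last e, fun h => (Γ.len_pos e).ne (congrArg Subtype.val h)⟩

instance (e : Γ.E) : ConnectedSpace (Γ.Seg e) :=
  isConnected_iff_connectedSpace.1 (isConnected_Icc zero_le)

theorem exists_rep (x : Γ.Point) :
    (∃ v, x = Γ.vertexPoint v) ∨ ∃ (e : Γ.E) (t : Γ.Seg e), t.IsInner ∧ x = Γ.edgePoint e t := by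
  induction x using Quot.ind with
  | mk p =>
    rcases p with v | ⟨e, t⟩
    · exact Or.inl ⟨v, rfl⟩
    · by_cases h : t.IsInner
      · exact Or.inr ⟨e, t, h, rfl⟩
      · rcases Seg.eq_ends_of_not_isInner h with rfl | rfl
        · exact Or.inl ⟨_, edgePoint_zero e⟩
        · exact Or.inl ⟨_, edgePoint_len e⟩

/-- Gluing identifies only ends of edges, so the predicate of being the inner coordinate `⟨e, t⟩`
descends to the quotient. -/
theorem sigma_eq_of_edgePoint_eq {e e' : Γ.E} {t : Γ.Seg e} {s : Γ.Seg e'} (ht : t.IsInner)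
    (h : Γ.edgePoint e' s = Γ.edgePoint e t) :
    (⟨e', s⟩ : Σ e : Γ.E, Γ.Seg e) = ⟨e, t⟩ := by
  let Q : Γ.PrePoint → Prop := Sum.elim (fun _ => False) (fun q => q = ⟨e, t⟩)
  have hQ : ∀ a b, Γ.Glue a b → Q a = Q b := by
    rintro a b (e1 | e1) <;> simp only [Q, Sum.elim_inl, Sum.elim_inr, eq_iff_iff, iff_false]
    · intro h
      cases h
      exact Seg.not_isInner_first _ ht
    · intro h
      cases h
      exact Seg.not_isInner_last _ ht
  exact (congrArg (Quot.lift Q hQ) h).mpr rfl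

theorem edgePoint_ne_vertexPoint {e : Γ.E} {t : Γ.Seg e} (ht : t.IsInner) (v : Γ.V) :
    Γ.edgePoint e t ≠ Γ.vertexPoint v := by
  let Q : Γ.PrePoint → Prop := Sum.elim (fun _ => False) (fun q => q = ⟨e, t⟩)
  have hQ : ∀ a b, Γ.Glue a b → Q a = Q b := by
    rintro a b (e1 | e1) <;> simp only [Q, Sum.elim_inl, Sum.elim_inr, eq_iff_iff, iff_false]
    · intro h
      cases h
      exact Seg.not_isInner_first _ ht
    · intro h
      cases h
      exact Seg.not_isInner_last _ ht
  exact fun h => (congrArg (Quot.lift Q hQ) h).mp rfl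

theorem edgePoint_inj {e : Γ.E} {s t : Γ.Seg e} (ht : t.IsInner)
    (h : Γ.edgePoint e s = Γ.edgePoint e t) : s = t := by
  have := sigma_eq_of_edgePoint_eq ht h
  simpa using this

/-- Over an inner point of `e` there is one coordinate. Every other fibre consists of ends, possibly
of both if `e` is a loop. -/
theorem finite_fiber (e : Γ.E) (x : Γ.Point) : {t : Γ.Seg e | Γ.edgePoint e t = x}.Finite := by
  by_cases h : ∃ t : Γ.Seg e, t.IsInner ∧ Γ.edgePoint e t = x
  · obtain ⟨t, ht, rfl⟩ := h
    exact (Set.finite_singleton t).subset fun s hs => edgePoint_inj ht hs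
  · refine (Seg.finite_not_isInner e).subset fun s hs hi => h ⟨s, hi, hs⟩

theorem finite_preimage_edgePoint (e : Γ.E) {B : Set Γ.Point} (hB : B.Finite) :
    (Γ.edgePoint e ⁻¹' B).Finite :=
  hB.preimage' fun x _ => finite_fiber e x

/-- The predicate `Q` of representing the vertex `v` descends to the quotient. Positive edge lengths
keep its clauses for the two ends apart. -/
theorem vertexPoint_injective : Function.Injective Γ.vertexPoint := by
  intro w v h
  let Q : Γ.PrePoint → Prop := Sum.elim (fun w => w = v)
    (fun q => ((q.2 : ℝ≥0∞) = 0 ∧ Γ.src q.1 = v) ∨ ((q.2 : ℝ≥0∞) = Γ.len q.1 ∧ Γ.tgt q.1 = v))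
  have hQ : ∀ a b, Γ.Glue a b → Q a = Q b := by
    rintro a b (e | e)
    · simp [Q, (Γ.len_pos e).ne]
    · simp [Q, (Γ.len_pos e).ne']
  exact (congrArg (Quot.lift Q hQ) h).mpr rfl

theorem isOpen_iff_edgePoint {O : Set Γ.Point} :
    IsOpen O ↔ ∀ e, IsOpen (Γ.edgePoint e ⁻¹' O) := by
  simp only [isOpen_iff_continuous_mem]
  exact continuous_iff

/-- As inner points are not glued to anything, the preimage of the image is `N` on `e` and empty on
every other edge. -/
theorem isOpen_image_edgePoint {e : Γ.E} {N : Set (Γ.Seg e)} (hN : IsOpen N)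
    (hi : ∀ t ∈ N, t.IsInner) : IsOpen (Γ.edgePoint e '' N) := by
  refine isOpen_iff_edgePoint.2 fun e' => ?_
  by_cases h : e' = e
  · subst h
    convert hN
    ext s
    refine ⟨?_, fun h => ⟨s, h, rfl⟩⟩
    rintro ⟨t, ht, h⟩
    exact edgePoint_inj (hi t ht) h.symm ▸ ht
  · convert isOpen_empty
    ext s
    simp only [Set.mem_preimage, Set.mem_image, Set.mem_empty_iff_false, iff_false]
    rintro ⟨t, ht, h'⟩
    exact h (congrArg Sigma.fst (sigma_eq_of_edgePoint_eq (hi t ht) h'.symm))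

theorem image_edgePoint_mem_nhds {e : Γ.E} {t : Γ.Seg e} (ht : t.IsInner) {N : Set (Γ.Seg e)}
    (hN : N ∈ 𝓝 t) : Γ.edgePoint e '' N ∈ 𝓝 (Γ.edgePoint e t) := by
  have h : {s | s ∈ N ∧ s.IsInner} ∈ 𝓝 t := Filter.inter_mem hN (Seg.eventually_isInner ht)
  obtain ⟨O, hO, hOo, htO⟩ := mem_nhds_iff.1 h
  refine Filter.mem_of_superset ((isOpen_image_edgePoint hOo fun s hs => (hO hs).2).mem_nhds
    ⟨t, htO, rfl⟩) (Set.image_mono fun s hs => (hO hs).1)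

instance : CompactSpace Γ.Point := by
  have := Γ.finite_E
  have := Γ.finite_V
  refine ⟨?_⟩
  have h : (Set.univ : Set Γ.Point) =
      Set.range Γ.vertexPoint ∪ ⋃ e, Set.range (Γ.edgePoint e) := by
    refine (Set.eq_univ_of_forall fun x => ?_).symm
    rcases exists_rep x with ⟨v, rfl⟩ | ⟨e, t, -, rfl⟩
    · exact Or.inl ⟨v, rfl⟩
    · exact Or.inr (Set.mem_iUnion.2 ⟨e, t, rfl⟩)
  rw [h]
  refine (Set.finite_range _).isCompact.union (isCompact_iUnion fun e => ?_)
  exact isCompact_range (continuous_edgePoint e)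

/-! ### The path distance -/

theorem IsPathLength.trans {x y z : Γ.Point} {L M : ℝ≥0∞} (h : Γ.IsPathLength x y L)
    (h' : Γ.IsPathLength y z M) : Γ.IsPathLength x z (L + M) := by
  induction h with
  | refl x => simpa using h'
  | step e s t y L h ih =>
    rw [add_assoc]
    exact IsPathLength.step e s t _ _ (ih h')

theorem isPathLength_gap (e : Γ.E) (s t : Γ.Seg e) :
    Γ.IsPathLength (Γ.edgePoint e s) (Γ.edgePoint e t) (gap s t) := by
  simpa [gap] using IsPathLength.step e s t _ _ (IsPathLength.refl (Γ.edgePoint e t))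

theorem IsPathLength.symm {x y : Γ.Point} {L : ℝ≥0∞} (h : Γ.IsPathLength x y L) :
    Γ.IsPathLength y x L := by
  induction h with
  | refl x => exact IsPathLength.refl x
  | step e s t y L h ih =>
    have := ih.trans (isPathLength_gap e t s)
    rw [gap_comm, add_comm] at this
    exact this

theorem dist_le_of_isPathLength {x y : Γ.Point} {L : ℝ≥0∞} (h : Γ.IsPathLength x y L) :
    Γ.dist x y ≤ L := sInf_le h

theorem exists_isPathLength_of_dist_lt {x y : Γ.Point} {M : ℝ≥0∞} (h : Γ.dist x y < M) :
    ∃ L < M, Γ.IsPathLength x y L := by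
  obtain ⟨L, hL, hLM⟩ := sInf_lt_iff.1 h
  exact ⟨L, hLM, hL⟩

theorem dist_self (x : Γ.Point) : Γ.dist x x = 0 :=
  le_antisymm (dist_le_of_isPathLength (IsPathLength.refl x)) zero_le

theorem dist_edgePoint_le (e : Γ.E) (s t : Γ.Seg e) :
    Γ.dist (Γ.edgePoint e s) (Γ.edgePoint e t) ≤ gap s t :=
  dist_le_of_isPathLength (isPathLength_gap e s t)

theorem dist_comm (x y : Γ.Point) : Γ.dist x y = Γ.dist y x :=
  congrArg sInf (Set.ext fun _ => ⟨IsPathLength.symm, IsPathLength.symm⟩)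

theorem dist_triangle (x y z : Γ.Point) : Γ.dist x z ≤ Γ.dist x y + Γ.dist y z := by
  refine le_of_forall_gt fun c hc => ?_
  by_cases hx : Γ.dist x y = ⊤
  · simp [hx] at hc
  by_cases hy : Γ.dist y z = ⊤
  · simp [hy] at hc
  obtain ⟨a, b, ha, hb, hab⟩ : ∃ a b, Γ.dist x y < a ∧ Γ.dist y z < b ∧ a + b < c := by
    obtain ⟨d, hd, hdc⟩ := exists_between hc
    obtain ⟨ε, hε, hεd⟩ := ENNReal.lt_iff_exists_add_pos_lt.1 hd
    have hε' : (ε / 2 : ℝ≥0∞) ≠ 0 := by simp [hε.ne']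
    refine ⟨Γ.dist x y + ε / 2, Γ.dist y z + ε / 2, ENNReal.lt_add_right hx hε',
      ENNReal.lt_add_right hy hε', lt_trans ?_ hdc⟩
    calc Γ.dist x y + ε / 2 + (Γ.dist y z + ε / 2)
        = Γ.dist x y + Γ.dist y z + (ε / 2 + ε / 2) := by ring
      _ < d := by rwa [ENNReal.add_halves]
  obtain ⟨L, hL, hL'⟩ := exists_isPathLength_of_dist_lt ha
  obtain ⟨M, hM, hM'⟩ := exists_isPathLength_of_dist_lt hb
  exact (dist_le_of_isPathLength (hL'.trans hM')).trans_lt ((ENNReal.add_lt_add hL hM).trans hab)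

theorem dist_edgePoint_le_add (e : Γ.E) (s t : Γ.Seg e) (y : Γ.Point) :
    Γ.dist (Γ.edgePoint e s) y ≤ gap s t + Γ.dist (Γ.edgePoint e t) y :=
  (dist_triangle _ _ _).trans (add_le_add_left (dist_edgePoint_le e s t) _)

/-- A function that is `1`-Lipschitz on the edges is `1`-Lipschitz. -/
theorem le_dist_add {g : Γ.Point → ℝ≥0∞}
    (hg : ∀ e (s t : Γ.Seg e), g (Γ.edgePoint e s) ≤ gap s t + g (Γ.edgePoint e t))
    (x y : Γ.Point) : g x ≤ Γ.dist x y + g y := by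
  have key : ∀ L, Γ.IsPathLength x y L → g x ≤ L + g y := by
    intro L h
    induction h with
    | refl x => simp
    | step e s t y L h ih =>
      refine (hg e s t).trans ?_
      rw [add_assoc]
      exact add_le_add_right ih _
  by_cases hy : g y = ⊤
  · simp [hy]
  rw [← tsub_le_iff_right]
  exact le_sInf fun L hL => tsub_le_iff_right.2 (key L hL)

theorem vertexPoint_mem_infinitePoints {v : Γ.V} :
    Γ.vertexPoint v ∈ Γ.infinitePoints ↔ ∃ e, Γ.len e = ⊤ ∧ Γ.tgt e = v := by
  constructor
  · rintro ⟨e, t, ht, h⟩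
    have hl : Γ.len e = ⊤ := top_le_iff.1 (ht ▸ t.2.2)
    refine ⟨e, hl, vertexPoint_injective ?_⟩
    rw [h, ← edgePoint_len]
    congr 1
    exact Subtype.ext (hl.trans ht.symm)
  · rintro ⟨e, he, rfl⟩
    exact ⟨e, Seg.last e, he, (edgePoint_len e).symm⟩

/-- The function that is `∞` at the points at infinity and `0` elsewhere satisfies the hypothesis of
`le_dist_add`, because leaving `∞` costs infinite length. -/
theorem dist_eq_top {x y : Γ.Point} (hx : x ∈ Γ.infinitePoints) (hy : y ∉ Γ.infinitePoints) :
    Γ.dist x y = ⊤ := by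
  classical
  have h := le_dist_add (g := fun z : Γ.Point => if z ∈ Γ.infinitePoints then (⊤ : ℝ≥0∞) else 0)
    (fun e s t => ?_) x y
  · simpa [hx, hy] using h
  · simp only [edgePoint_mem_infinitePoints]
    by_cases hs : (s : ℝ≥0∞) = ⊤ <;> by_cases ht : (t : ℝ≥0∞) = ⊤ <;> simp [hs, ht, gap_top]

/-- A chain of edges given by connectedness may visit vertices at infinity. Retracting each of them
to the finite end of its edge collapses the infinite edges, and only steps of finite length remain.
-/
theorem dist_vertexPoint_ne_top {v w : Γ.V} (hv : Γ.vertexPoint v ∉ Γ.infinitePoints)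
    (hw : Γ.vertexPoint w ∉ Γ.infinitePoints) :
    Γ.dist (Γ.vertexPoint v) (Γ.vertexPoint w) ≠ ⊤ := by
  classical
  -- an infinite vertex is moved to the other end of its edge
  let ρ : Γ.V → Γ.V := fun v => if h : ∃ e, Γ.len e = ⊤ ∧ Γ.tgt e = v then Γ.src h.choose else v
  have hρ : ∀ v, Γ.vertexPoint v ∉ Γ.infinitePoints → ρ v = v := fun v hv =>
    dif_neg (mt vertexPoint_mem_infinitePoints.2 hv)
  have hsrc : ∀ e, ρ (Γ.src e) = Γ.src e := fun e =>
    dif_neg fun ⟨e', he', h⟩ => src_ne_tgt he' h.symm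
  have htop : ∀ e, Γ.len e = ⊤ → ρ (Γ.tgt e) = Γ.src e := by
    intro e he
    have h : ∃ e', Γ.len e' = ⊤ ∧ Γ.tgt e' = Γ.tgt e := ⟨e, he, rfl⟩
    have h1 : ρ (Γ.tgt e) = Γ.src h.choose := dif_pos h
    rw [h1, eq_of_tgt_eq he h.choose_spec.2]
  have key : ∀ a b, Relation.EqvGen (fun a b => ∃ e, Γ.src e = a ∧ Γ.tgt e = b) a b →
      Γ.dist (Γ.vertexPoint (ρ a)) (Γ.vertexPoint (ρ b)) ≠ ⊤ := by
    intro a b h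
    induction h with
    | rel a b h =>
      obtain ⟨e, rfl, rfl⟩ := h
      rw [hsrc]
      by_cases he : Γ.len e = ⊤
      · simp [htop e he, dist_self]
      · have h1 : ρ (Γ.tgt e) = Γ.tgt e :=
          dif_neg fun ⟨e', he', h⟩ => he (eq_of_tgt_eq he' h.symm ▸ he')
        rw [h1, ← edgePoint_zero, ← edgePoint_len]
        exact ne_top_of_le_ne_top (gap_ne_top ENNReal.zero_ne_top he) (dist_edgePoint_le e _ _)
    | refl a => simp [dist_self]
    | symm a b _ ih => rwa [dist_comm]
    | trans a b c _ _ ih ih' =>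
      exact ne_top_of_le_ne_top (ENNReal.add_ne_top.2 ⟨ih, ih'⟩) (dist_triangle _ _ _)
  simpa [hρ v hv, hρ w hw] using key v w (Γ.connected v w)

theorem vertexPoint_src_not_mem (e : Γ.E) : Γ.vertexPoint (Γ.src e) ∉ Γ.infinitePoints :=
  fun h => by
    obtain ⟨e', he', h'⟩ := vertexPoint_mem_infinitePoints.1 h
    exact src_ne_tgt he' h'.symm

theorem exists_vertex_dist_ne_top {x : Γ.Point} (hx : x ∉ Γ.infinitePoints) :
    ∃ v, Γ.vertexPoint v ∉ Γ.infinitePoints ∧ Γ.dist x (Γ.vertexPoint v) ≠ ⊤ := by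
  rcases exists_rep x with ⟨v, rfl⟩ | ⟨e, t, -, rfl⟩
  · exact ⟨v, hx, by simp [dist_self]⟩
  · refine ⟨Γ.src e, vertexPoint_src_not_mem e, ?_⟩
    rw [← edgePoint_zero]
    exact ne_top_of_le_ne_top
      (gap_ne_top (mt edgePoint_mem_infinitePoints.2 hx) ENNReal.zero_ne_top)
      (dist_edgePoint_le e _ _)

theorem dist_ne_top {x y : Γ.Point} (hx : x ∉ Γ.infinitePoints) (hy : y ∉ Γ.infinitePoints) :
    Γ.dist x y ≠ ⊤ := by
  obtain ⟨v, hv, hxv⟩ := exists_vertex_dist_ne_top hx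
  obtain ⟨w, hw, hyw⟩ := exists_vertex_dist_ne_top hy
  refine ne_top_of_le_ne_top (ENNReal.add_ne_top.2 ⟨hxv, ENNReal.add_ne_top.2
    ⟨dist_vertexPoint_ne_top hv hw, dist_comm y _ ▸ hyw⟩⟩) ?_
  exact (dist_triangle _ _ _).trans (add_le_add_right (dist_triangle _ _ _) _)

/-- The distance from a point on an edge, as the minimum over the three ways to leave it. -/
theorem dist_edgePoint (e : Γ.E) (t : Γ.Seg e) (y : Γ.Point) :
    Γ.dist (Γ.edgePoint e t) y =
      min (min ((t : ℝ≥0∞) + Γ.dist (Γ.vertexPoint (Γ.src e)) y)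
        ((Γ.len e - t) + Γ.dist (Γ.vertexPoint (Γ.tgt e)) y))
        (⨅ s ∈ {s : Γ.Seg e | Γ.edgePoint e s = y}, gap t s) := by
  apply le_antisymm
  · refine le_min (le_min ?_ ?_) (le_iInf₂ fun s hs => ?_)
    · have := dist_edgePoint_le_add e t (Seg.first e) y
      rwa [edgePoint_zero, gap_comm, gap_of_le zero_le, tsub_zero] at this
    · have := dist_edgePoint_le_add e t (Seg.last e) y
      rwa [edgePoint_len, gap_of_le t.2.2] at this
    · rw [← (hs : Γ.edgePoint e s = y)]
      exact dist_edgePoint_le e t s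
  · refine le_sInf fun L hL => ?_
    -- The starting point becomes a variable, so that the induction on the path can vary its
    -- coordinate `t`.
    obtain ⟨x, hx⟩ : ∃ x, x = Γ.edgePoint e t := ⟨_, rfl⟩
    have hL' : Γ.IsPathLength x y L := hx ▸ hL
    clear hL
    induction hL' generalizing t with
    | refl x =>
      refine (min_le_right _ _).trans ((iInf₂_le t hx.symm).trans ?_)
      simp [gap_self]
    | step e' s' t' y L h ih =>
      -- From an inner point the first segment runs along `e`, and each of the three expressions
      -- changes by at most the length of that segment. At an end, one of the first two expressions
      -- is the distance itself.
      by_cases hi : t.IsInner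
      · have := sigma_eq_of_edgePoint_eq hi hx
        cases this
        refine le_trans ?_ (add_le_add_right (ih t' rfl) (gap t t'))
        rw [← min_add_add_left, ← min_add_add_left]
        refine min_le_min (min_le_min ?_ ?_) ?_
        · rw [← add_assoc]
          exact add_le_add_left (le_gap_add _ _) _
        · rw [← add_assoc]
          exact add_le_add_left (sub_le_gap_add_sub _ _ _) _
        · rw [ENNReal.add_iInf]
          refine le_iInf fun s => ?_
          rw [ENNReal.add_iInf]
          refine le_iInf fun hs => ?_
          exact (iInf₂_le s hs).trans (gap_triangle _ _ _)
      · have hp := IsPathLength.step e' s' t' y L h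
        rw [hx] at hp
        have hd := dist_le_of_isPathLength hp
        refine le_trans (min_le_left _ _) ?_
        rcases Seg.eq_ends_of_not_isInner hi with rfl | rfl
        · refine (min_le_left _ _).trans ?_
          rw [edgePoint_zero] at hd
          simpa using hd
        · refine (min_le_right _ _).trans ?_
          rw [edgePoint_len] at hd
          simpa using hd

/-- On a short segment inside an edge, the distance is the difference of the coordinates. -/
theorem dist_edgePoint_eq_gap {e : Γ.E} {s t : Γ.Seg e} (hs : s.IsInner)
    (h₁ : (s : ℝ≥0∞) ≤ 2 * t) (h₂ : (2 * t : ℝ≥0∞) ≤ Γ.len e + s) :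
    Γ.dist (Γ.edgePoint e t) (Γ.edgePoint e s) = gap t s := by
  by_cases htt : (t : ℝ≥0∞) = ⊤
  · rw [htt, gap_top hs.ne_top]
    exact dist_eq_top (edgePoint_mem_infinitePoints.2 htt)
      (mt edgePoint_mem_infinitePoints.1 hs.ne_top)
  refine le_antisymm (dist_edgePoint_le e t s) ?_
  rw [dist_edgePoint]
  -- The hypotheses say that `s - t ≤ t` and `t - s ≤ len e - t`, so reaching an end of the edge
  -- already costs at least `gap t s`.
  refine le_min (le_min (le_add_right ?_) (le_add_right ?_)) (le_iInf₂ fun s' hs' => ?_)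
  · rcases le_total (t : ℝ≥0∞) s with h | h
    · rw [gap_of_le h, tsub_le_iff_right, ← two_mul]
      exact h₁
    · rw [gap_comm, gap_of_le h]
      exact tsub_le_self
  · rcases le_total (t : ℝ≥0∞) s with h | h
    · rw [gap_of_le h]
      exact tsub_le_tsub_right s.2.2 _
    · rw [gap_comm, gap_of_le h]
      rw [tsub_le_iff_right, ← ENNReal.add_le_add_iff_right htt, ← two_mul, add_right_comm,
        tsub_add_cancel_of_le t.2.2]
      exact h₂
  · rw [edgePoint_inj hs hs']

end TropicalCurve

namespace TropicalCurve

variable {Γ : TropicalCurve.{u}}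

/-! ### Functions on an edge that are affine near a point -/

/-- Near `t`, the function `u` is affine with slope `k`. -/
def IsAffineAt {e : Γ.E} (u : Γ.Seg e → EReal) (t : Γ.Seg e) (k : ℤ) (c : ℝ) : Prop :=
  ∀ᶠ s : Γ.Seg e in 𝓝 t, u s = ((c + k * (s : ℝ≥0∞).toReal : ℝ) : EReal)

theorem Seg.toReal_injOn {e : Γ.E} {s t : Γ.Seg e} (hs : (s : ℝ≥0∞) ≠ ⊤) (ht : (t : ℝ≥0∞) ≠ ⊤)
    (h : (s : ℝ≥0∞).toReal = (t : ℝ≥0∞).toReal) : s = t :=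
  Subtype.ext ((ENNReal.toReal_eq_toReal_iff' hs ht).1 h)

theorem Seg.eventually_ne_top {e : Γ.E} {t : Γ.Seg e} (ht : (t : ℝ≥0∞) ≠ ⊤) :
    ∀ᶠ s : Γ.Seg e in 𝓝 t, (s : ℝ≥0∞) ≠ ⊤ :=
  (continuous_subtype_val.tendsto t).eventually (isOpen_ne.mem_nhds ht)

theorem Seg.eventually_notMem {e : Γ.E} (t : Γ.Seg e) {P : Set (Γ.Seg e)} (hP : P.Finite) :
    ∀ᶠ s in 𝓝[≠] t, s ∉ P := by
  have h : (P \ {t})ᶜ ∈ 𝓝 t := (hP.sdiff (t := {t})).isClosed.isOpen_compl.mem_nhds (by simp)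
  filter_upwards [nhdsWithin_le_nhds h, self_mem_nhdsWithin] with s hs hst hsP
  exact hs ⟨hsP, hst⟩

/-- Two affine functions that agree near a point are equal. -/
theorem eq_of_eventually_affine_eq {e : Γ.E} {t : Γ.Seg e} (ht : (t : ℝ≥0∞) ≠ ⊤) {k k' c c' : ℝ}
    (h : ∀ᶠ s : Γ.Seg e in 𝓝 t,
      c + k * (s : ℝ≥0∞).toReal = c' + k' * (s : ℝ≥0∞).toReal) : k = k' ∧ c = c' := by
  obtain ⟨s, ⟨hs, hs'⟩, hst⟩ := (((h.and
    (Seg.eventually_ne_top ht)).filter_mono (nhdsWithin_le_nhds (s := {t}ᶜ))).and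
    self_mem_nhdsWithin).exists
  have h1 := h.self_of_nhds
  have hne : (s : ℝ≥0∞).toReal - (t : ℝ≥0∞).toReal ≠ 0 := fun h0 =>
    hst (Seg.toReal_injOn hs' ht (sub_eq_zero.1 h0))
  have hk : k = k' := by
    apply mul_right_cancel₀ hne
    linarith
  subst hk
  exact ⟨rfl, by linarith⟩

theorem IsAffineAt.unique {e : Γ.E} {u : Γ.Seg e → EReal} {t : Γ.Seg e} (ht : (t : ℝ≥0∞) ≠ ⊤)
    {k k' : ℤ} {c c' : ℝ} (h : IsAffineAt u t k c) (h' : IsAffineAt u t k' c') :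
    k = k' ∧ c = c' := by
  have := eq_of_eventually_affine_eq (k := k) (k' := k') (c := c) (c' := c') ht (by
    filter_upwards [h, h'] with s hs hs'
    exact EReal.coe_injective (hs.symm.trans hs'))
  exact_mod_cast this

theorem isPiecewiseAffine_affine {e : Γ.E} (k : ℤ) (c : ℝ) :
    IsPiecewiseAffine (fun s : Γ.Seg e => ((c + k * (s : ℝ≥0∞).toReal : ℝ) : EReal)) :=
  ⟨∅, fun _ _ _ => ⟨k, c, fun _ _ => rfl⟩⟩

theorem IsPiecewiseAffine.neg {e : Γ.E} {u : Γ.Seg e → EReal} (hu : IsPiecewiseAffine u) :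
    IsPiecewiseAffine (fun s => - u s) := by
  obtain ⟨P, hP⟩ := hu
  refine ⟨P, fun I hI hIP => ?_⟩
  obtain ⟨k, c, h⟩ := hP I hI hIP
  refine ⟨-k, -c, fun t ht => ?_⟩
  simp only [h t ht, ← EReal.coe_neg]
  congr 1
  push_cast
  ring

theorem IsPiecewiseAffine.inf {e : Γ.E} {u v : Γ.Seg e → EReal} (hu : IsPiecewiseAffine u)
    (hv : IsPiecewiseAffine v) : IsPiecewiseAffine (fun t => min (u t) (v t)) := by
  have h := (hu.neg.sup hv.neg).neg
  refine h.congr fun t _ => ?_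
  rw [EReal.max_neg_neg, neg_neg]

/-- A piecewise affine function is affine near almost all points. -/
theorem IsPiecewiseAffine.exists_isAffineAt {e : Γ.E} {u : Γ.Seg e → EReal}
    (hu : IsPiecewiseAffine u) : ∃ P : Set (Γ.Seg e), P.Finite ∧
      ∀ t ∉ P, (t : ℝ≥0∞) ≠ ⊤ → ∃ k c, IsAffineAt u t k c := by
  obtain ⟨P, hP⟩ := hu
  refine ⟨P, P.finite_toSet, fun t ht htop => ?_⟩
  -- The finite points lying on the same side of every breakpoint as `t`.
  let I : Set (Γ.Seg e) := {s | (s : ℝ≥0∞) ≠ ⊤ ∧ ∀ p ∈ P, (p < t → p < s) ∧ (t < p → s < p)}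
  have hI : I.OrdConnected := by
    refine ⟨fun a ha b hb x hx => ⟨ne_top_of_le_ne_top hb.1 hx.2, fun p hp => ?_⟩⟩
    exact ⟨fun h => ((ha.2 p hp).1 h).trans_le hx.1, fun h => hx.2.trans_lt ((hb.2 p hp).2 h)⟩
  have hIP : ∀ s ∈ I, s ∉ P := by
    intro s hs hsP
    rcases lt_trichotomy s t with h | h | h
    · exact lt_irrefl _ ((hs.2 s hsP).1 h)
    · exact ht (h ▸ hsP)
    · exact lt_irrefl _ ((hs.2 s hsP).2 h)
  obtain ⟨k, c, h⟩ := hP I hI fun s hs => ⟨hIP s hs, hs.1⟩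
  refine ⟨k, c, Filter.mem_of_superset (x := I) ?_ h⟩
  refine Filter.inter_mem (Seg.eventually_ne_top htop) ?_
  change ∀ᶠ s in 𝓝 t, ∀ p ∈ P, (p < t → p < s) ∧ (t < p → s < p)
  rw [Filter.eventually_all_finset]
  intro p _
  refine Filter.Eventually.and ?_ ?_
  · by_cases h : p < t
    · exact (lt_mem_nhds h).mono fun s hs _ => hs
    · simp [h]
  · by_cases h : t < p
    · exact (gt_mem_nhds h).mono fun s hs _ => hs
    · simp [h]

theorem Seg.isPreconnected {e : Γ.E} {I : Set (Γ.Seg e)} (hI : I.OrdConnected) :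
    IsPreconnected I := by
  rw [← Topology.IsInducing.subtypeVal.isPreconnected_image]
  refine Set.OrdConnected.isPreconnected ⟨?_⟩
  rintro _ ⟨a, ha, rfl⟩ _ ⟨b, hb, rfl⟩ x hx
  exact ⟨⟨x, zero_le, hx.2.trans b.2.2⟩, hI.out ha hb hx, rfl⟩

/-- A function that is affine near almost all points is piecewise affine. -/
theorem isPiecewiseAffine_of_isAffineAt {e : Γ.E} {u : Γ.Seg e → EReal} {P : Set (Γ.Seg e)}
    (hP : P.Finite) (h : ∀ t ∉ P, (t : ℝ≥0∞) ≠ ⊤ → ∃ k c, IsAffineAt u t k c) :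
    IsPiecewiseAffine u := by
  refine ⟨hP.toFinset, fun I hI hIP => ?_⟩
  have h' : ∀ t : Γ.Seg e, ∃ (k : ℤ) (c : ℝ), t ∈ I → IsAffineAt u t k c := by
    intro t
    by_cases ht : t ∈ I
    · obtain ⟨k, c, hk⟩ := h t (fun h => (hIP t ht).1 (hP.mem_toFinset.2 h)) (hIP t ht).2
      exact ⟨k, c, fun _ => hk⟩
    · exact ⟨0, 0, fun h => absurd h ht⟩
  choose k c hkc using h'
  rcases I.eq_empty_or_nonempty with rfl | ⟨t₀, ht₀⟩
  · exact ⟨0, 0, by simp⟩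
  refine ⟨k t₀, c t₀, fun t ht => ?_⟩
  -- The slope and the constant are locally constant by `IsAffineAt.unique`, hence constant on the
  -- connected set `I`.
  have key : k t₀ = k t ∧ c t₀ = c t := by
    refine (Seg.isPreconnected hI).induction₂ (fun s t => k s = k t ∧ c s = c t) ?_
      (fun x y z _ _ _ h h' => ⟨h.1.trans h'.1, h.2.trans h'.2⟩)
      (fun x y _ _ h => ⟨h.1.symm, h.2.symm⟩) ht₀ ht
    intro s hs
    filter_upwards [nhdsWithin_le_nhds (hkc s hs).eventually_nhds, self_mem_nhdsWithin]
      with s' h1 h2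
    exact IsAffineAt.unique (hIP s' h2).2 h1 (hkc s' h2)
  rw [key.1, key.2]
  exact (hkc t ht).self_of_nhds

/-! ### The mean value inequality -/

/-- Without exceptional points this is the mean value inequality. An exceptional point inside the
interval is removed by splitting the interval there, where `w` is still continuous. -/
theorem abs_sub_le_of_hasDerivAt_off_finset {w : ℝ → ℝ} {K : ℝ} (Q : Finset ℝ) {a b : ℝ}
    (hab : a ≤ b) (hw : ContinuousOn w (Set.Icc a b))
    (hd : ∀ x ∈ Set.Ioo a b, x ∉ Q → ∃ k, |k| ≤ K ∧ HasDerivAt w k x) :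
    |w b - w a| ≤ K * (b - a) := by
  classical
  induction Q using Finset.induction generalizing a b with
  | empty =>
    have hdiff : DifferentiableOn ℝ w (interior (Set.Icc a b)) := by
      intro x hx
      rw [interior_Icc] at hx
      obtain ⟨k, -, hk⟩ := hd x hx (by simp)
      exact hk.differentiableAt.differentiableWithinAt
    have hder : ∀ x ∈ interior (Set.Icc a b), |deriv w x| ≤ K := by
      intro x hx
      rw [interior_Icc] at hx
      obtain ⟨k, hk, hk'⟩ := hd x hx (by simp)
      rwa [hk'.deriv]
    have ha : a ∈ Set.Icc a b := ⟨le_rfl, hab⟩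
    have hb : b ∈ Set.Icc a b := ⟨hab, le_rfl⟩
    rw [abs_le]
    constructor
    · have := (convex_Icc a b).mul_sub_le_image_sub_of_le_deriv hw hdiff (C := -K)
        (fun x hx => (abs_le.1 (hder x hx)).1) a ha b hb hab
      linarith
    · exact (convex_Icc a b).image_sub_le_mul_sub_of_deriv_le hw hdiff
        (fun x hx => (abs_le.1 (hder x hx)).2) a ha b hb hab
  | insert p Q _ ih =>
    by_cases hp : p ∈ Set.Ioo a b
    · have h1 := ih hp.1.le (hw.mono (Set.Icc_subset_Icc_right hp.2.le)) fun x hx hxQ =>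
        hd x ⟨hx.1, hx.2.trans hp.2⟩ (by simp [hxQ, hx.2.ne])
      have h2 := ih hp.2.le (hw.mono (Set.Icc_subset_Icc_left hp.1.le)) fun x hx hxQ =>
        hd x ⟨hp.1.trans hx.1, hx.2⟩ (by simp [hxQ, hx.1.ne'])
      calc |w b - w a| ≤ |w b - w p| + |w p - w a| := abs_sub_le _ _ _
        _ ≤ K * (b - p) + K * (p - a) := add_le_add h2 h1
        _ = K * (b - a) := by ring
    · refine ih hab hw fun x hx hxQ => hd x hx ?_
      rw [Finset.mem_insert, not_or]
      exact ⟨fun h => hp (h ▸ hx), hxQ⟩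

/-- The point of an edge with the given real coordinate. -/
noncomputable def Seg.ofReal (e : Γ.E) (x : ℝ) : Γ.Seg e :=
  ⟨min (ENNReal.ofReal x) (Γ.len e), zero_le, min_le_right _ _⟩

theorem Seg.continuous_ofReal (e : Γ.E) : Continuous (Seg.ofReal e) :=
  Continuous.subtype_mk (ENNReal.continuous_ofReal.min continuous_const) _

theorem Seg.ofReal_toReal {e : Γ.E} {t : Γ.Seg e} (ht : (t : ℝ≥0∞) ≠ ⊤) :
    Seg.ofReal e (t : ℝ≥0∞).toReal = t := by
  apply Subtype.ext
  simp [Seg.ofReal, ENNReal.ofReal_toReal ht, t.2.2]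

theorem Seg.toReal_ofReal {e : Γ.E} {x : ℝ} (hx : 0 ≤ x) (h : ENNReal.ofReal x ≤ Γ.len e) :
    (Seg.ofReal e x : ℝ≥0∞).toReal = x := by
  simp [Seg.ofReal, h, hx]

/-- A continuous function on an edge whose slopes are almost everywhere bounded by `K` is
`K`-Lipschitz. -/
theorem abs_sub_le_of_isAffineAt {e : Γ.E} {u : Γ.Seg e → EReal} (hu : Continuous u)
    (hfin : ∀ t : Γ.Seg e, (t : ℝ≥0∞) ≠ ⊤ → u t ≠ ⊥ ∧ u t ≠ ⊤) {P : Set (Γ.Seg e)}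
    (hP : P.Finite) {K : ℝ}
    (h : ∀ t ∉ P, t.IsInner → ∃ (k : ℤ) (c : ℝ), |(k : ℝ)| ≤ K ∧ IsAffineAt u t k c)
    {s t : Γ.Seg e} (hs : (s : ℝ≥0∞) ≠ ⊤) (ht : (t : ℝ≥0∞) ≠ ⊤) :
    |(u s).toReal - (u t).toReal| ≤ K * |(s : ℝ≥0∞).toReal - (t : ℝ≥0∞).toReal| := by
  wlog hst : t ≤ s generalizing s t
  · rw [abs_sub_comm, abs_sub_comm (s : ℝ≥0∞).toReal]
    exact this ht hs (le_of_not_ge hst)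
  have hst' : (t : ℝ≥0∞).toReal ≤ (s : ℝ≥0∞).toReal := ENNReal.toReal_mono hs hst
  have htop : ∀ x : ℝ, ((Seg.ofReal e x : Γ.Seg e) : ℝ≥0∞) ≠ ⊤ := fun x =>
    ne_top_of_le_ne_top ENNReal.ofReal_ne_top (min_le_left _ _)
  have hlen : ∀ x ≤ (s : ℝ≥0∞).toReal, ENNReal.ofReal x ≤ Γ.len e := fun x hx =>
    (ENNReal.ofReal_le_ofReal hx).trans ((ENNReal.ofReal_toReal hs).trans_le s.2.2)
  have key := abs_sub_le_of_hasDerivAt_off_finset (w := fun x => (u (Seg.ofReal e x)).toReal)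
    (K := K) (hP.toFinset.image fun p : Γ.Seg e => (p : ℝ≥0∞).toReal) hst' ?_ ?_
  · simp only [Seg.ofReal_toReal hs, Seg.ofReal_toReal ht] at key
    rwa [abs_of_nonneg (sub_nonneg.2 hst')]
  · refine Continuous.continuousOn (continuous_iff_continuousAt.2 fun x => ?_)
    exact ContinuousAt.comp (f := fun x => u (Seg.ofReal e x))
      (EReal.tendsto_toReal (hfin _ (htop x)).2 (hfin _ (htop x)).1)
      (hu.comp (Seg.continuous_ofReal e)).continuousAt
  · intro x hx hxP
    have hx0 : 0 < x := ENNReal.toReal_nonneg.trans_lt hx.1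
    have hxr := Seg.toReal_ofReal hx0.le (hlen x hx.2.le)
    have hxP' : Seg.ofReal e x ∉ P := fun hm =>
      hxP (Finset.mem_image.2 ⟨_, hP.mem_toFinset.2 hm, hxr⟩)
    have hin : (Seg.ofReal e x).IsInner := by
      refine ⟨lt_min (ENNReal.ofReal_pos.2 hx0) (Γ.len_pos e),
        (min_le_left _ _).trans_lt (lt_of_lt_of_le ?_ s.2.2)⟩
      rw [← ENNReal.ofReal_toReal hs]
      exact (ENNReal.ofReal_lt_ofReal_iff (hx0.trans hx.2)).2 hx.2
    obtain ⟨k, c, hk, hkc⟩ := h (Seg.ofReal e x) hxP' hin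
    refine ⟨k, hk, ?_⟩
    have h1 : HasDerivAt (fun y : ℝ => c + k * y) k x := by
      simpa using ((hasDerivAt_id x).const_mul (k : ℝ)).const_add c
    refine h1.congr_of_eventuallyEq ?_
    filter_upwards [(Seg.continuous_ofReal e).continuousAt.eventually hkc, Ioo_mem_nhds hx0 hx.2]
      with y hy hy'
    rw [hy, EReal.toReal_coe, Seg.toReal_ofReal hy'.1.le (hlen y hy'.2.le)]

end TropicalCurve

namespace TropicalCurve

variable {Γ : TropicalCurve.{u}}

/-! ### The distance from a point as a rational function -/

theorem finite_of_edgePoint_eq {e : Γ.E} {s : Γ.Seg e} {y : Γ.Point} (hy : y ∉ Γ.infinitePoints)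
    (h : Γ.edgePoint e s = y) : (s : ℝ≥0∞) ≠ ⊤ :=
  fun hs => hy (h ▸ edgePoint_mem_infinitePoints.2 hs)

theorem dist_tgt_eq_top {e : Γ.E} (he : Γ.len e = ⊤) {y : Γ.Point} (hy : y ∉ Γ.infinitePoints) :
    Γ.dist (Γ.vertexPoint (Γ.tgt e)) y = ⊤ :=
  dist_eq_top (vertexPoint_mem_infinitePoints.2 ⟨e, he, rfl⟩) hy

/-- A finite infimum preserves continuity and piecewise affinity, which is what the formula is
needed for. -/
theorem dist_edgePoint_eq_finset_inf (e : Γ.E) (t : Γ.Seg e) (y : Γ.Point) :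
    Γ.dist (Γ.edgePoint e t) y =
      min (min ((t : ℝ≥0∞) + Γ.dist (Γ.vertexPoint (Γ.src e)) y)
        ((Γ.len e - t) + Γ.dist (Γ.vertexPoint (Γ.tgt e)) y))
        ((finite_fiber e y).toFinset.inf fun s : Γ.Seg e => gap t s) := by
  rw [dist_edgePoint, Finset.inf_eq_iInf]
  simp

theorem continuous_dist {y : Γ.Point} (hy : y ∉ Γ.infinitePoints) :
    Continuous fun x => Γ.dist x y := by
  refine continuous_iff.2 fun e => ?_
  simp only [dist_edgePoint_eq_finset_inf]
  refine ((continuous_subtype_val.add continuous_const).min ?_).min ?_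
  · by_cases he : Γ.len e = ⊤
    · simp only [dist_tgt_eq_top he hy, add_top]
      exact continuous_const
    · exact ((ENNReal.continuous_sub_left he).comp continuous_subtype_val).add continuous_const
  · refine Continuous.finset_inf_apply fun s hs => ?_
    exact (continuous_gap (finite_of_edgePoint_eq hy ((finite_fiber e y).mem_toFinset.1 hs))).comp
      continuous_subtype_val

/-- A function on an edge with values in `[0, ∞]` that is piecewise affine or infinite. -/
def IsTopOrPiecewiseAffine {e : Γ.E} (u : Γ.Seg e → ℝ≥0∞) : Prop :=
  (∀ t : Γ.Seg e, (t : ℝ≥0∞) ≠ ⊤ → u t = ⊤) ∨ IsPiecewiseAffine (fun t => (u t : EReal))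

theorem coe_min_ennreal (a b : ℝ≥0∞) : ((min a b : ℝ≥0∞) : EReal) = min (a : EReal) b :=
  Monotone.map_min (f := ((↑) : ℝ≥0∞ → EReal)) EReal.coe_ennreal_strictMono.monotone

theorem coe_max_real (a b : ℝ) : ((max a b : ℝ) : EReal) = max (a : EReal) b :=
  Monotone.map_max (f := ((↑) : ℝ → EReal)) EReal.coe_strictMono.monotone

/-- Some of the routes in `dist_edgePoint` may be unavailable, that is, of length `∞` at all finite
coordinates. The minimum absorbs these. -/
theorem IsTopOrPiecewiseAffine.min {e : Γ.E} {u v : Γ.Seg e → ℝ≥0∞}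
    (hu : IsTopOrPiecewiseAffine u) (hv : IsTopOrPiecewiseAffine v) :
    IsTopOrPiecewiseAffine (fun t => min (u t) (v t)) := by
  rcases hu with hu | hu
  · rcases hv with hv | hv
    · exact Or.inl fun t ht => by simp [hu t ht, hv t ht]
    · exact Or.inr (hv.congr fun t ht => by simp [hu t ht])
  · rcases hv with hv | hv
    · exact Or.inr (hu.congr fun t ht => by simp [hv t ht])
    · exact Or.inr ((hu.inf hv).congr fun t _ => (coe_min_ennreal _ _).symm)

theorem coe_ennreal_eq_coe_toReal {a : ℝ≥0∞} (ha : a ≠ ⊤) : (a : EReal) = (a.toReal : EReal) :=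
  (EReal.coe_toReal (by simpa using ha) (by simp)).symm.trans (by simp)

theorem isTopOrPiecewiseAffine_add (e : Γ.E) (a : ℝ≥0∞) :
    IsTopOrPiecewiseAffine (fun t : Γ.Seg e => (t : ℝ≥0∞) + a) := by
  by_cases ha : a = ⊤
  · exact Or.inl fun t _ => by simp [ha]
  · refine Or.inr ((isPiecewiseAffine_affine 1 a.toReal).congr fun t ht => ?_)
    rw [coe_ennreal_eq_coe_toReal (ENNReal.add_ne_top.2 ⟨ht, ha⟩), ENNReal.toReal_add ht ha]
    congr 1
    push_cast
    ring

theorem isTopOrPiecewiseAffine_sub_add (e : Γ.E) (a : ℝ≥0∞) :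
    IsTopOrPiecewiseAffine (fun t : Γ.Seg e => (Γ.len e - t) + a) := by
  by_cases ha : a = ⊤
  · exact Or.inl fun t _ => by simp [ha]
  by_cases he : Γ.len e = ⊤
  · exact Or.inl fun t ht => by simp [he, ENNReal.top_sub ht]
  · refine Or.inr ((isPiecewiseAffine_affine (-1) ((Γ.len e).toReal + a.toReal)).congr
      fun t ht => ?_)
    rw [coe_ennreal_eq_coe_toReal (ENNReal.add_ne_top.2 ⟨ENNReal.sub_ne_top he, ha⟩),
      ENNReal.toReal_add (ENNReal.sub_ne_top he) ha, ENNReal.toReal_sub_of_le t.2.2 he]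
    congr 1
    push_cast
    ring

theorem isTopOrPiecewiseAffine_gap {e : Γ.E} {s : Γ.Seg e} (hs : (s : ℝ≥0∞) ≠ ⊤) :
    IsTopOrPiecewiseAffine (fun t : Γ.Seg e => gap t s) := by
  refine Or.inr (((isPiecewiseAffine_affine 1 (-(s : ℝ≥0∞).toReal)).sup
    (isPiecewiseAffine_affine (-1) (s : ℝ≥0∞).toReal)).congr fun t ht => ?_)
  rw [coe_ennreal_eq_coe_toReal (gap_ne_top ht hs), toReal_gap ht hs, abs_eq_max_neg,
    ← coe_max_real]
  congr 1
  push_cast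
  congr 1 <;> ring

theorem isTopOrPiecewiseAffine_finset_inf {e : Γ.E} (A : Finset (Γ.Seg e))
    (hA : ∀ s ∈ A, (s : ℝ≥0∞) ≠ ⊤) :
    IsTopOrPiecewiseAffine (fun t : Γ.Seg e => A.inf fun s => gap t s) := by
  classical
  induction A using Finset.induction with
  | empty => exact Or.inl fun t _ => by simp
  | insert s A _ ih =>
    simp only [Finset.inf_insert]
    exact (isTopOrPiecewiseAffine_gap (hA s (by simp))).min
      (ih fun s' hs' => hA s' (by simp [hs']))

theorem isRational_dist {y : Γ.Point} (hy : y ∉ Γ.infinitePoints) :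
    Γ.IsRational fun x => (Γ.dist x y : EReal) := by
  refine ⟨continuous_coe_ennreal_ereal.comp (continuous_dist hy), Or.inr ⟨fun x hx => ?_,
    fun e => ?_⟩⟩
  · exact ⟨by simp, by simpa using dist_ne_top hx hy⟩
  · have h : IsTopOrPiecewiseAffine (fun t => Γ.dist (Γ.edgePoint e t) y) := by
      simp only [dist_edgePoint_eq_finset_inf]
      exact ((isTopOrPiecewiseAffine_add e _).min (isTopOrPiecewiseAffine_sub_add e _)).min
        (isTopOrPiecewiseAffine_finset_inf _ fun s hs =>
          finite_of_edgePoint_eq hy ((finite_fiber e y).mem_toFinset.1 hs))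
    -- The distance cannot be identically `∞`, because the source of `e` is a finite point.
    refine h.resolve_left fun h => ?_
    refine dist_ne_top ?_ hy (h (Seg.first e) ENNReal.zero_ne_top)
    rw [edgePoint_zero]
    exact vertexPoint_src_not_mem e

namespace RatFun

/-- The distance from a finite point. -/
noncomputable def distFun (y : Γ.Point) (hy : y ∉ Γ.infinitePoints) : Γ.RatFun :=
  ⟨_, isRational_dist hy⟩

theorem distFun_apply {y : Γ.Point} (hy : y ∉ Γ.infinitePoints) (x : Γ.Point) :
    distFun y hy x = (Γ.dist x y : EReal) := rfl

end RatFun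

/-! ### Separation of points -/

/-- Let `δ > 0` be a lower bound for the edge lengths. The distance to `w` along a single edge at
`w`, cut off at `δ`, is `1`-Lipschitz. It is `δ` at `v` and `0` at `w`. -/
theorem dist_vertexPoint_ne_zero {v w : Γ.V} (h : v ≠ w) :
    Γ.dist (Γ.vertexPoint v) (Γ.vertexPoint w) ≠ 0 := by
  classical
  have := Γ.finite_E
  obtain ⟨δ, hδ, hδl⟩ : ∃ δ : ℝ≥0∞, 0 < δ ∧ ∀ e, δ ≤ Γ.len e := by
    rcases isEmpty_or_nonempty Γ.E with hE | hE
    · exact ⟨1, one_pos, fun e => hE.elim e⟩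
    · obtain ⟨e, he⟩ := Finite.exists_min Γ.len
      exact ⟨Γ.len e, Γ.len_pos e, he⟩
  let g₀ : Γ.PrePoint → ℝ≥0∞ := Sum.elim (fun u => if u = w then 0 else δ) fun q =>
    min δ (min (if Γ.src q.1 = w then (q.2 : ℝ≥0∞) else ⊤)
      (if Γ.tgt q.1 = w then Γ.len q.1 - q.2 else ⊤))
  have hg₀ : ∀ a b, Γ.Glue a b → g₀ a = g₀ b := by
    rintro a b (e | e)
    · simp only [g₀, Sum.elim_inr, Sum.elim_inl]
      split_ifs <;> simp [hδl e]
    · simp only [g₀, Sum.elim_inr, Sum.elim_inl]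
      split_ifs <;> simp [hδl e]
  have key := le_dist_add (g := Quot.lift g₀ hg₀) (fun e s t => ?_) (Γ.vertexPoint v)
    (Γ.vertexPoint w)
  · have h1 : Quot.lift g₀ hg₀ (Γ.vertexPoint v) = δ := if_neg h
    have h2 : Quot.lift g₀ hg₀ (Γ.vertexPoint w) = 0 := if_pos rfl
    rw [h1, h2, add_zero] at key
    exact (hδ.trans_le key).ne'
  · change min δ (min (if Γ.src e = w then (s : ℝ≥0∞) else ⊤)
        (if Γ.tgt e = w then Γ.len e - s else ⊤)) ≤ gap s t +
      min δ (min (if Γ.src e = w then (t : ℝ≥0∞) else ⊤)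
        (if Γ.tgt e = w then Γ.len e - t else ⊤))
    rw [← min_add_add_left, ← min_add_add_left]
    refine min_le_min le_add_self (min_le_min ?_ ?_)
    · split_ifs
      · exact le_gap_add _ _
      · simp
    · split_ifs
      · exact sub_le_gap_add_sub _ _ _
      · simp

theorem eq_of_dist_edgePoint_eq_zero {e : Γ.E} {t : Γ.Seg e} (ht : t.IsInner) {y : Γ.Point}
    (h : Γ.dist (Γ.edgePoint e t) y = 0) : Γ.edgePoint e t = y := by
  rw [dist_edgePoint_eq_finset_inf] at h
  rcases min_choice (min ((t : ℝ≥0∞) + Γ.dist (Γ.vertexPoint (Γ.src e)) y)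
        ((Γ.len e - t) + Γ.dist (Γ.vertexPoint (Γ.tgt e)) y))
        ((finite_fiber e y).toFinset.inf fun s : Γ.Seg e => gap t s) with h1 | h1
  · rw [h1] at h
    rcases min_choice ((t : ℝ≥0∞) + Γ.dist (Γ.vertexPoint (Γ.src e)) y)
        ((Γ.len e - t) + Γ.dist (Γ.vertexPoint (Γ.tgt e)) y) with h2 | h2
    · rw [h2, add_eq_zero] at h
      exact absurd h.1 ht.1.ne'
    · rw [h2, add_eq_zero, tsub_eq_zero_iff_le] at h
      exact absurd h.1 (not_le.2 ht.2)
  · rw [h1] at h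
    rcases (finite_fiber e y).toFinset.eq_empty_or_nonempty with h2 | h2
    · simp [h2] at h
    · obtain ⟨s, hs, hs'⟩ := Finset.exists_mem_eq_inf _ h2 fun s : Γ.Seg e => gap t s
      rw [hs'] at h
      rw [Subtype.ext (eq_of_gap_eq_zero h)]
      exact (finite_fiber e y).mem_toFinset.1 hs

theorem eq_of_dist_eq_zero {x y : Γ.Point} (h : Γ.dist x y = 0) : x = y := by
  rcases exists_rep x with ⟨v, rfl⟩ | ⟨e, t, ht, rfl⟩
  · rcases exists_rep y with ⟨w, rfl⟩ | ⟨e, t, ht, rfl⟩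
    · by_contra hne
      exact dist_vertexPoint_ne_zero (fun h' => hne (congrArg _ h')) h
    · rw [dist_comm] at h
      exact (eq_of_dist_edgePoint_eq_zero ht h).symm
  · exact eq_of_dist_edgePoint_eq_zero ht h

/-- The coordinate of an infinite edge, extended by zero, is a rational function. -/
theorem exists_ratFun_coord {e : Γ.E} (he : Γ.len e = ⊤) :
    ∃ f : Γ.RatFun, f ≠ 0 ∧ ∀ x ∈ Γ.infinitePoints, f x = ⊤ ↔ x = Γ.vertexPoint (Γ.tgt e) := by
  classical
  let g₀ : Γ.PrePoint → EReal := Sum.elim (fun u => if u = Γ.tgt e then ⊤ else 0) fun q =>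
    if q.1 = e then ((q.2 : ℝ≥0∞) : EReal) else 0
  have hg₀ : ∀ a b, Γ.Glue a b → g₀ a = g₀ b := by
    rintro a b (e' | e')
    · simp [g₀, src_ne_tgt he]
    · simp only [g₀, Sum.elim_inr, Sum.elim_inl]
      by_cases h : e' = e
      · simp [h, he]
      · have : Γ.tgt e' ≠ Γ.tgt e := fun h' => h (eq_of_tgt_eq he h')
        simp [h, this]
  let g : Γ.Point → EReal := Quot.lift g₀ hg₀
  have hge : ∀ e' (t : Γ.Seg e'), g (Γ.edgePoint e' t) =
      if e' = e then ((t : ℝ≥0∞) : EReal) else 0 := fun _ _ => rfl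
  have hgv : ∀ v, g (Γ.vertexPoint v) = if v = Γ.tgt e then ⊤ else 0 := fun _ => rfl
  have hg : Γ.IsRational g := by
    refine ⟨continuous_iff.2 fun e' => ?_, Or.inr ⟨fun x hx => ?_, fun e' => ?_⟩⟩
    · by_cases h : e' = e
      · simp only [hge, h, if_true]
        exact continuous_coe_ennreal_ereal.comp continuous_subtype_val
      · simp only [hge, h, if_false]
        exact continuous_const
    · rcases exists_rep x with ⟨v, rfl⟩ | ⟨e', t, ht, rfl⟩
      · have : v ≠ Γ.tgt e := fun h => hx (vertexPoint_mem_infinitePoints.2 ⟨e, he, h.symm⟩)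
        simp [hgv, this]
      · rw [hge]
        split_ifs <;> simp [ht.ne_top]
    · by_cases h : e' = e
      · refine (isPiecewiseAffine_affine 1 0).congr fun t ht => ?_
        rw [hge, if_pos h, coe_ennreal_eq_coe_toReal ht]
        simp
      · refine (isPiecewiseAffine_const 0).congr fun t ht => ?_
        rw [hge, if_neg h]
        simp
  refine ⟨⟨g, hg⟩, fun h0 => ?_, fun x hx => ?_⟩
  · have : g (Γ.vertexPoint (Γ.tgt e)) = ⊥ :=
      congrFun (congrArg Subtype.val h0) (Γ.vertexPoint (Γ.tgt e))
    simp [hgv] at this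
  · obtain ⟨e', t, ht, rfl⟩ := hx
    have hl : Γ.len e' = ⊤ := top_le_iff.1 (ht ▸ t.2.2)
    have hte : Γ.edgePoint e' t = Γ.vertexPoint (Γ.tgt e') := by
      rw [← edgePoint_len]
      congr 1
      exact Subtype.ext (ht.trans hl.symm)
    change g (Γ.edgePoint e' t) = ⊤ ↔ _
    rw [hte, hgv]
    constructor
    · intro h
      by_contra hne
      rw [if_neg fun h' => hne (congrArg _ h')] at h
      exact EReal.zero_ne_top h
    · intro h
      rw [if_pos (vertexPoint_injective h)]

theorem exists_eq_vertexPoint_of_mem {x : Γ.Point} (hx : x ∈ Γ.infinitePoints) :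
    ∃ e, Γ.len e = ⊤ ∧ x = Γ.vertexPoint (Γ.tgt e) := by
  obtain ⟨e, t, ht, rfl⟩ := hx
  have hl : Γ.len e = ⊤ := top_le_iff.1 (ht ▸ t.2.2)
  refine ⟨e, hl, ?_⟩
  rw [← edgePoint_len]
  congr 1
  exact Subtype.ext (ht.trans hl.symm)

namespace RatFun

theorem ne_bot_ne_top {f : Γ.RatFun} (hf : f ≠ 0) {x : Γ.Point} (hx : x ∉ Γ.infinitePoints) :
    f x ≠ ⊥ ∧ f x ≠ ⊤ := by
  refine (f.2.2.resolve_left fun h => hf ?_).1 x hx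
  exact Subtype.ext (funext h)

theorem isPiecewiseAffine {f : Γ.RatFun} (hf : f ≠ 0) (e : Γ.E) :
    IsPiecewiseAffine (fun t : Γ.Seg e => f (Γ.edgePoint e t)) := by
  refine (f.2.2.resolve_left fun h => hf ?_).2 e
  exact Subtype.ext (funext h)

theorem coe_toReal_apply {f : Γ.RatFun} (hf : f ≠ 0) {x : Γ.Point} (hx : x ∉ Γ.infinitePoints) :
    ((f x).toReal : EReal) = f x :=
  EReal.coe_toReal (ne_bot_ne_top hf hx).2 (ne_bot_ne_top hf hx).1

/-- The distance from a finite point vanishes only there. It is `∞` at every point at infinity, so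
two of those are separated by the coordinate of an infinite edge instead. -/
theorem separates {x y : Γ.Point} (h : ∀ f : Γ.RatFun, f x = f y) : x = y := by
  by_cases hy : y ∈ Γ.infinitePoints
  · by_cases hx : x ∈ Γ.infinitePoints
    · obtain ⟨e, he, rfl⟩ := exists_eq_vertexPoint_of_mem hy
      obtain ⟨f, -, hf⟩ := exists_ratFun_coord he
      rw [← hf x hx, h f, hf _ hy]
    · refine (eq_of_dist_eq_zero ?_).symm
      have := h (distFun x hx)
      rw [distFun_apply, distFun_apply, dist_self] at this
      exact (EReal.coe_ennreal_injective this).symm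
  · refine eq_of_dist_eq_zero ?_
    have := h (distFun y hy)
    rw [distFun_apply, distFun_apply, dist_self] at this
    exact EReal.coe_ennreal_injective this

/-- This describes the points at infinity by values of rational functions, a description that
survives the passage along an induced isomorphism. -/
theorem mem_infinitePoints_iff {x : Γ.Point} :
    x ∈ Γ.infinitePoints ↔ ∃ f : Γ.RatFun, f ≠ 0 ∧ f x = ⊤ := by
  constructor
  · intro hx
    obtain ⟨e, he, rfl⟩ := exists_eq_vertexPoint_of_mem hx
    obtain ⟨f, hf0, hf⟩ := exists_ratFun_coord he
    exact ⟨f, hf0, (hf _ hx).2 rfl⟩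
  · rintro ⟨f, hf0, hf⟩
    by_contra hx
    exact (ne_bot_ne_top hf0 hx).2 hf

/-- The evaluation of all rational functions at a point. -/
def evalAll (x : Γ.Point) : Γ.RatFun → EReal := fun f => f x

theorem continuous_evalAll : Continuous (evalAll (Γ := Γ)) :=
  continuous_pi fun f => f.2.1

theorem evalAll_injective : Function.Injective (evalAll (Γ := Γ)) :=
  fun _ _ h => separates fun f => congrFun h f

end RatFun

instance : T2Space Γ.Point :=
  T2Space.of_injective_continuous RatFun.evalAll_injective RatFun.continuous_evalAll

/-- A continuous injection from a compact space to a Hausdorff space is a closed embedding. Hence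
the curve has the topology induced by its rational functions. -/
theorem continuous_of_ratFun {X : Type*} [TopologicalSpace X] {φ : X → Γ.Point}
    (h : ∀ f : Γ.RatFun, Continuous fun x => f (φ x)) : Continuous φ := by
  have := RatFun.continuous_evalAll.isClosedEmbedding (RatFun.evalAll_injective (Γ := Γ))
  exact this.isInducing.continuous_iff.2 (continuous_pi h)

/-! ### Constants and inverses -/

namespace RatFun

/-- The constant rational functions. -/
def const (a : ℝ) : Γ.RatFun := ⟨_, isRational_const a⟩

theorem const_apply (a : ℝ) (x : Γ.Point) : (const a : Γ.RatFun) x = (a : EReal) := rfl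

theorem exists_notMem_infinitePoints (Γ : TropicalCurve.{u}) : ∃ x, x ∉ Γ.infinitePoints := by
  rcases isEmpty_or_nonempty Γ.E with hE | ⟨⟨e⟩⟩
  · obtain ⟨v⟩ := Γ.nonempty
    exact ⟨Γ.vertexPoint v, fun ⟨e, _⟩ => hE.elim e⟩
  · exact ⟨_, vertexPoint_src_not_mem e⟩

theorem const_ne_zero (a : ℝ) : (const a : Γ.RatFun) ≠ 0 := by
  obtain ⟨x, -⟩ := exists_notMem_infinitePoints Γ
  intro h
  exact EReal.coe_ne_bot a (congrArg (fun f : Γ.RatFun => f x) h)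

theorem const_injective : Function.Injective (const (Γ := Γ)) := by
  obtain ⟨x, -⟩ := exists_notMem_infinitePoints Γ
  intro a b h
  exact EReal.coe_injective (congrArg (fun f : Γ.RatFun => f x) h)

theorem const_mul_const (a b : ℝ) : (const a * const b : Γ.RatFun) = const (a + b) :=
  ext_finite fun x hx => by simp [mul_apply _ _ hx, const_apply]

theorem const_add_const (a b : ℝ) : (const a + const b : Γ.RatFun) = const (max a b) :=
  ext_finite fun x _ => by simp [add_apply, const_apply, coe_max_real]

theorem isRational_neg {f : Γ.RatFun} (hf : f ≠ 0) : Γ.IsRational fun x => - f x := by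
  refine ⟨f.2.1.neg, Or.inr ⟨fun x hx => ?_, fun e => (isPiecewiseAffine hf e).neg⟩⟩
  have := ne_bot_ne_top hf hx
  simp [this]

/-- The multiplicative inverse of a nonzero rational function. -/
noncomputable def inv (f : Γ.RatFun) (hf : f ≠ 0) : Γ.RatFun := ⟨_, isRational_neg hf⟩

theorem inv_apply {f : Γ.RatFun} (hf : f ≠ 0) (x : Γ.Point) : inv f hf x = - f x := rfl

theorem eq_inv_of_mul_eq_one {f g : Γ.RatFun} (hf : f ≠ 0) (h : f * g = 1) : g = inv f hf := by
  have hg : g ≠ 0 := by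
    rintro rfl
    rw [mul_zero] at h
    exact const_ne_zero 0 h.symm
  refine ext_finite fun x hx => ?_
  have h1 : f x + g x = 0 := by rw [← mul_apply f g hx, h, one_apply]
  rw [inv_apply, ← coe_toReal_apply hf hx, ← coe_toReal_apply hg hx, ← EReal.coe_neg]
  rw [← coe_toReal_apply hf hx, ← coe_toReal_apply hg hx, ← EReal.coe_add,
    ← EReal.coe_zero, EReal.coe_eq_coe_iff] at h1
  congr 1
  linarith

theorem mul_inv_eq_one {f : Γ.RatFun} (hf : f ≠ 0) : f * inv f hf = 1 := by
  refine ext_finite fun x hx => ?_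
  rw [mul_apply _ _ hx, one_apply, inv_apply, ← coe_toReal_apply hf hx, ← EReal.coe_neg,
    ← EReal.coe_add]
  simp

theorem isRational_const_add (a : ℝ) (f : Γ.RatFun) : Γ.IsRational fun x => (a : EReal) + f x := by
  refine ⟨continuous_iff_continuousAt.2 fun x => ?_, ?_⟩
  · exact ContinuousAt.comp (f := fun x => ((a : EReal), f x))
      (EReal.continuousAt_add (Or.inl (EReal.coe_ne_top a)) (Or.inl (EReal.coe_ne_bot a)))
      (continuous_const.prodMk f.2.1).continuousAt
  · rcases f.2.2 with h | h
    · exact Or.inl fun x => by simp [h x]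
    · refine Or.inr ⟨fun x hx => ?_, fun e => (isPiecewiseAffine_const a).add (h.2 e)⟩
      have h1 := h.1 x hx
      lift f x to ℝ using ⟨h1.2, h1.1⟩ with b
      rw [← EReal.coe_add]
      exact ⟨EReal.coe_ne_bot _, EReal.coe_ne_top _⟩

/-- Unlike `mul_apply`, this holds at infinity too: adding a real constant is continuous on `[-∞,
∞]`, so no indeterminate sum arises. -/
theorem const_mul_apply (a : ℝ) (f : Γ.RatFun) (x : Γ.Point) :
    (const a * f : Γ.RatFun) x = a + f x := by
  have : const a * f = ⟨_, isRational_const_add a f⟩ :=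
    ext_finite fun x hx => by rw [mul_apply _ _ hx, const_apply]
  rw [this]

end RatFun

end TropicalCurve

namespace TropicalCurve

variable {Γ : TropicalCurve.{u}}

/-! ### Scaling of extended real numbers -/

theorem continuous_coe_mul (r : ℝ) : Continuous fun a : EReal => (r : EReal) * a := by
  rcases eq_or_ne r 0 with rfl | hr
  · simpa using continuous_const
  have hr' : (r : EReal) ≠ 0 := by exact_mod_cast hr
  refine continuous_iff_continuousAt.2 fun a => ?_
  exact ContinuousAt.comp (f := fun a : EReal => ((r : EReal), a))
    (EReal.continuousAt_mul (Or.inl hr') (Or.inl hr') (Or.inl (EReal.coe_ne_bot r))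
      (Or.inl (EReal.coe_ne_top r)))
    (continuous_const.prodMk continuous_id).continuousAt

theorem inv_mul_cancel_coe {r : ℝ} (hr : r ≠ 0) (a : EReal) :
    ((r⁻¹ : ℝ) : EReal) * ((r : EReal) * a) = a := by
  rw [← mul_assoc, ← EReal.coe_mul, inv_mul_cancel₀ hr, EReal.coe_one, one_mul]

theorem mul_inv_cancel_coe {r : ℝ} (hr : r ≠ 0) (a : EReal) :
    (r : EReal) * (((r⁻¹ : ℝ) : EReal) * a) = a := by
  rw [← mul_assoc, ← EReal.coe_mul, mul_inv_cancel₀ hr, EReal.coe_one, one_mul]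

theorem coe_mul_injective {r : ℝ} (hr : r ≠ 0) :
    Function.Injective fun a : EReal => (r : EReal) * a :=
  Function.LeftInverse.injective (inv_mul_cancel_coe hr)

/-! ### Constant functions are the divisible ones -/

namespace RatFun

theorem pow_ne_zero' {g : Γ.RatFun} {n : ℕ} (h : g ^ (n + 1) ≠ 0) : g ≠ 0 := by
  rintro rfl
  exact h (by simp [pow_succ])

theorem toReal_pow_apply {g : Γ.RatFun} (hg : g ≠ 0) (n : ℕ) {x : Γ.Point}
    (hx : x ∉ Γ.infinitePoints) : (g ^ n) x = ((n * (g x).toReal : ℝ) : EReal) := by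
  induction n with
  | zero => simp [one_apply]
  | succ n ih =>
    rw [pow_succ, mul_apply _ _ hx, ih, ← coe_toReal_apply hg hx, ← EReal.coe_add,
      EReal.toReal_coe]
    congr 1
    push_cast
    ring

/-- A root of order `|k| + 1` has an integer slope `m` with `k = (|k| + 1) * m`, which forces `k =
0`. -/
theorem slope_eq_zero_of_divisible {f : Γ.RatFun} (hf : f ≠ 0)
    (h : ∀ n : ℕ, ∃ g : Γ.RatFun, g ^ (n + 1) = f) {e : Γ.E} {t : Γ.Seg e}
    (ht : (t : ℝ≥0∞) ≠ ⊤) {k : ℤ} {c : ℝ}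
    (hk : IsAffineAt (fun s => f (Γ.edgePoint e s)) t k c) : k = 0 := by
  obtain ⟨g, hg⟩ := h k.natAbs
  have hg0 : g ≠ 0 := pow_ne_zero' (hg ▸ hf)
  obtain ⟨P, hP, hPg⟩ := (isPiecewiseAffine hg0 e).exists_isAffineAt
  -- The root `g` may have a breakpoint at `t`, hence the passage to a nearby point `t'`.
  obtain ⟨t', ⟨hkt', ht'⟩, hP'⟩ := (((hk.eventually_nhds.and (Seg.eventually_ne_top ht)).filter_mono
    nhdsWithin_le_nhds).and (Seg.eventually_notMem t hP)).exists
  obtain ⟨m, d, hm⟩ := hPg t' hP' ht'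
  have key := eq_of_eventually_affine_eq (k := k) (c := c) (k' := (k.natAbs + 1 : ℕ) * m)
    (c' := (k.natAbs + 1 : ℕ) * d) ht' (by
      filter_upwards [hkt', hm, Seg.eventually_ne_top ht'] with s h1 h2 h3
      have hx : Γ.edgePoint e s ∉ Γ.infinitePoints := mt edgePoint_mem_infinitePoints.1 h3
      have h4 := toReal_pow_apply hg0 (k.natAbs + 1) hx
      rw [hg, h1, EReal.coe_eq_coe_iff, h2, EReal.toReal_coe] at h4
      rw [h4]
      ring)
  have h1 : k = (k.natAbs + 1 : ℕ) * m := by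
    apply Int.cast_injective (α := ℝ)
    rw [Int.cast_mul, Int.cast_natCast]
    exact key.1
  refine Int.eq_zero_of_abs_lt_dvd (m := (k.natAbs + 1 : ℕ)) ⟨m, h1⟩ ?_
  rw [Int.abs_eq_natAbs]
  push_cast
  omega

/-- A segment of finite length either joins two finite points or stays at `∞`. -/
theorem apply_eq_of_isPathLength {f : Γ.Point → EReal}
    (hf : ∀ e (s t : Γ.Seg e), (s : ℝ≥0∞) ≠ ⊤ → (t : ℝ≥0∞) ≠ ⊤ →
      f (Γ.edgePoint e s) = f (Γ.edgePoint e t)) {x y : Γ.Point} {L : ℝ≥0∞}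
    (h : Γ.IsPathLength x y L) (hL : L ≠ ⊤) : f x = f y := by
  induction h with
  | refl x => rfl
  | step e s t y L h ih =>
    have hL' := ENNReal.add_ne_top.1 hL
    rw [← ih hL'.2]
    have hst : gap s t ≠ ⊤ := hL'.1
    by_cases hs : (s : ℝ≥0∞) = ⊤
    · by_cases ht : (t : ℝ≥0∞) = ⊤
      · rw [Subtype.ext (hs.trans ht.symm)]
      · rw [hs, gap_top ht] at hst
        exact absurd rfl hst
    · by_cases ht : (t : ℝ≥0∞) = ⊤
      · rw [ht, gap_comm, gap_top hs] at hst
        exact absurd rfl hst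
      · exact hf e s t hs ht

/-- All slopes vanish, so the mean value inequality with bound `0` makes `f` constant on the finite
part of each edge, and paths of finite length connect all finite points. The function `-∞` is
divisible as well, hence the hypothesis `f ≠ 0`. -/
theorem eq_const_of_divisible {f : Γ.RatFun} (hf : f ≠ 0)
    (h : ∀ n : ℕ, ∃ g : Γ.RatFun, g ^ (n + 1) = f) : ∃ a, f = const a := by
  have hedge : ∀ e (s t : Γ.Seg e), (s : ℝ≥0∞) ≠ ⊤ → (t : ℝ≥0∞) ≠ ⊤ →
      f (Γ.edgePoint e s) = f (Γ.edgePoint e t) := by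
    intro e s t hs ht
    have hfin : ∀ t : Γ.Seg e, (t : ℝ≥0∞) ≠ ⊤ → Γ.edgePoint e t ∉ Γ.infinitePoints :=
      fun t ht => mt edgePoint_mem_infinitePoints.1 ht
    obtain ⟨P, hP, hPf⟩ := (isPiecewiseAffine hf e).exists_isAffineAt
    have key := abs_sub_le_of_isAffineAt (u := fun s => f (Γ.edgePoint e s)) (K := 0)
      (f.2.1.comp (continuous_edgePoint e)) (fun t ht => ne_bot_ne_top hf (hfin t ht)) hP
      (fun t htP hti => by
        obtain ⟨k, c, hk⟩ := hPf t htP hti.ne_top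
        exact ⟨k, c, by simp [slope_eq_zero_of_divisible hf h hti.ne_top hk], hk⟩) hs ht
    rw [zero_mul, abs_nonpos_iff, sub_eq_zero] at key
    rw [← coe_toReal_apply hf (hfin s hs), ← coe_toReal_apply hf (hfin t ht)]
    exact congrArg _ key
  obtain ⟨y, hy⟩ := exists_notMem_infinitePoints Γ
  refine ⟨(f y).toReal, ext_finite fun x hx => ?_⟩
  obtain ⟨L, hL, hL'⟩ := exists_isPathLength_of_dist_lt (lt_top_iff_ne_top.2 (dist_ne_top hx hy))
  rw [const_apply, coe_toReal_apply hf hy]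
  exact apply_eq_of_isPathLength hedge hL' hL.ne

theorem exists_pow_eq_const (a : ℝ) (n : ℕ) : ∃ g : Γ.RatFun, g ^ (n + 1) = const a := by
  refine ⟨const (a / (n + 1)), ext_finite fun x hx => ?_⟩
  rw [toReal_pow_apply (const_ne_zero _) _ hx, const_apply, const_apply, EReal.toReal_coe]
  congr 1
  push_cast
  field_simp

end RatFun

variable {Γ₁ Γ₂ : TropicalCurve.{u}}

open RatFun

theorem map_ne_zero_of_equiv (φ : Γ₁.RatFun ≃+* Γ₂.RatFun) {f : Γ₁.RatFun} (hf : f ≠ 0) :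
    φ f ≠ 0 := fun h => hf (φ.injective (h.trans (map_zero φ).symm))

theorem exists_map_const (φ : Γ₁.RatFun ≃+* Γ₂.RatFun) (a : ℝ) : ∃ b, φ (const a) = const b := by
  refine eq_const_of_divisible (map_ne_zero_of_equiv φ (const_ne_zero a)) fun n => ?_
  obtain ⟨g, hg⟩ := exists_pow_eq_const (Γ := Γ₁) a n
  exact ⟨φ g, by rw [← map_pow, hg]⟩

/-- Additivity gives linearity over `ℚ`. A real `a` violating the formula would be separated from `ρ
a / ρ 1` by a rational number, against monotonicity. -/
theorem eq_mul_of_additive_of_monotone {ρ : ℝ → ℝ} (hadd : ∀ a b, ρ (a + b) = ρ a + ρ b)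
    (hmono : StrictMono ρ) (a : ℝ) : ρ a = ρ 1 * a := by
  let F : ℝ →+ ℝ := AddMonoidHom.mk' ρ hadd
  have hq : ∀ q : ℚ, ρ q = ρ 1 * q := by
    intro q
    have := map_rat_smul F q (1 : ℝ)
    simp only [Rat.smul_def, mul_one] at this
    rw [mul_comm]
    exact this
  have h1 : 0 < ρ 1 := by
    have h0 : ρ 0 = 0 := map_zero F
    rw [← h0]
    exact hmono one_pos
  refine le_antisymm (le_of_not_gt fun h => ?_) (le_of_not_gt fun h => ?_)
  · have h2 : a < ρ a / ρ 1 := by rwa [lt_div_iff₀ h1, mul_comm]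
    obtain ⟨q, hq1, hq2⟩ := exists_rat_btwn h2
    rw [lt_div_iff₀ h1, mul_comm, ← hq] at hq2
    exact lt_asymm hq2 (hmono hq1)
  · have h2 : ρ a / ρ 1 < a := by rwa [div_lt_iff₀ h1, mul_comm]
    obtain ⟨q, hq1, hq2⟩ := exists_rat_btwn h2
    rw [div_lt_iff₀ h1, mul_comm, ← hq] at hq1
    exact lt_asymm hq1 (hmono hq2)

/-- A semiring isomorphism scales the constants by a positive factor. -/
theorem exists_factor (φ : Γ₁.RatFun ≃+* Γ₂.RatFun) :
    ∃ r : ℝ, 0 < r ∧ ∀ a, φ (const a) = const (r * a) := by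
  choose ρ hρ using exists_map_const φ
  have hadd : ∀ a b, ρ (a + b) = ρ a + ρ b := by
    intro a b
    apply const_injective (Γ := Γ₂)
    rw [← const_mul_const, ← hρ, ← hρ, ← hρ, ← const_mul_const, map_mul]
  have hinj : Function.Injective ρ := by
    intro a b hab
    apply const_injective (Γ := Γ₁)
    apply φ.injective
    rw [hρ, hρ, hab]
  have hmono : Monotone ρ := by
    intro a b hab
    -- The maximum is the addition of the semiring, so the order of the constants is preserved.
    have h : ρ (max a b) = max (ρ a) (ρ b) := by
      apply const_injective (Γ := Γ₂)
      rw [← const_add_const, ← hρ, ← hρ, ← hρ, ← const_add_const, map_add]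
    rw [max_eq_right hab] at h
    exact h ▸ le_max_left _ _
  have hlin := eq_mul_of_additive_of_monotone hadd (hmono.strictMono_of_injective hinj)
  refine ⟨ρ 1, ?_, fun a => by rw [hρ, hlin]⟩
  have h0 : ρ 0 = 0 := by rw [hlin, mul_zero]
  rw [← h0]
  exact (hmono.strictMono_of_injective hinj) one_pos

/-! ### The map on points induced by a semiring isomorphism -/

theorem map_inv_apply (φ : Γ₁.RatFun ≃+* Γ₂.RatFun) {f : Γ₁.RatFun} (hf : f ≠ 0) (y : Γ₂.Point) :
    φ (inv f hf) y = - φ f y := by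
  have h : φ f * φ (inv f hf) = 1 := by rw [← map_mul, mul_inv_eq_one, map_one]
  rw [eq_inv_of_mul_eq_one (map_ne_zero_of_equiv φ hf) h, inv_apply]

/-- For a real `b` strictly between the two values, take `g = f - b / r`. Then `φ g = φ f - b` is
negative at `y`, and `g` is positive at `x`. -/
theorem exists_pos_of_lt {φ : Γ₁.RatFun ≃+* Γ₂.RatFun} {r : ℝ} (hr : 0 < r)
    (hφ : ∀ a, φ (const a) = const (r * a)) {f : Γ₁.RatFun} {x : Γ₁.Point} {y : Γ₂.Point}
    (h : φ f y < r * f x) : ∃ g : Γ₁.RatFun, φ g y ≤ 0 ∧ 0 < g x := by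
  obtain ⟨b, hb, hb'⟩ := EReal.lt_iff_exists_real_btwn.1 h
  refine ⟨const (-(b / r)) * f, ?_, ?_⟩
  · rw [map_mul, hφ, const_mul_apply]
    have : r * -(b / r) = -b := by field_simp
    rw [this]
    calc ((-b : ℝ) : EReal) + φ f y ≤ ((-b : ℝ) : EReal) + b := add_le_add_right hb.le _
      _ = 0 := by rw [← EReal.coe_add]; simp
  · rw [const_mul_apply]
    induction hfx : f x with
    | bot =>
      rw [hfx, EReal.coe_mul_bot_of_pos hr] at hb'
      exact absurd hb' not_lt_bot
    | top => rw [EReal.coe_add_top]; exact EReal.zero_lt_top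
    | coe a =>
      rw [hfx, ← EReal.coe_mul, EReal.coe_lt_coe_iff] at hb'
      rw [← EReal.coe_add]
      refine EReal.coe_pos.2 ?_
      have : b / r < a := by rwa [div_lt_iff₀' hr]
      linarith

/-- The evaluation at a point of `Γ₂` comes from the evaluation at a point of `Γ₁`. -/
theorem exists_point {φ : Γ₁.RatFun ≃+* Γ₂.RatFun} {r : ℝ} (hr : 0 < r)
    (hφ : ∀ a, φ (const a) = const (r * a)) (y : Γ₂.Point) :
    ∃ x, ∀ f : Γ₁.RatFun, φ f y = r * f x := by
  by_contra! hcon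
  have hpos : ∀ x : Γ₁.Point, ∃ g : Γ₁.RatFun, φ g y ≤ 0 ∧ 0 < g x := by
    intro x
    obtain ⟨f, hf⟩ := hcon x
    have hf0 : f ≠ 0 := by
      rintro rfl
      rw [map_zero, zero_apply, zero_apply, EReal.coe_mul_bot_of_pos hr] at hf
      exact hf rfl
    rcases lt_or_gt_of_ne hf with h | h
    · exact exists_pos_of_lt hr hφ h
    -- The reversed inequality for `f` is the required one for `-f`.
    · refine exists_pos_of_lt hr hφ (f := inv f hf0) ?_
      rw [map_inv_apply, inv_apply, mul_neg]
      exact EReal.neg_lt_neg_iff.2 h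
  -- Both conditions on `g` pass to the maximum of two functions, which is the sum in the semiring.
  -- This yields one `g` that is positive on all of `Γ₁`.
  obtain ⟨g, hg, hg'⟩ := isCompact_univ.induction_on (X := Γ₁.Point)
    (p := fun S => ∃ g : Γ₁.RatFun, φ g y ≤ 0 ∧ ∀ x ∈ S, 0 < g x)
    ⟨0, by simp [zero_apply], by simp⟩
    (fun s t hst ⟨g, hg, hg'⟩ => ⟨g, hg, fun x hx => hg' x (hst hx)⟩)
    (fun s t ⟨g, hg, hg'⟩ ⟨f, hf, hf'⟩ => ⟨g + f, by
      rw [map_add, add_apply]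
      exact max_le hg hf, fun x hx => by
      rw [add_apply]
      exact hx.elim (fun h => lt_max_of_lt_left (hg' x h)) fun h => lt_max_of_lt_right (hf' x h)⟩)
    (fun x _ => by
      obtain ⟨g, hg, hgx⟩ := hpos x
      exact ⟨{z | 0 < g z}, nhdsWithin_le_nhds ((isOpen_lt continuous_const g.2.1).mem_nhds hgx),
        g, hg, fun z hz => hz⟩)
  obtain ⟨x₁, -⟩ := exists_notMem_infinitePoints Γ₁
  obtain ⟨x₀, -, hx₀⟩ := isCompact_univ.exists_isMinOn ⟨x₁, Set.mem_univ _⟩ g.2.1.continuousOn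
  obtain ⟨ε, hε, hε'⟩ := EReal.lt_iff_exists_real_btwn.1 (hg' x₀ (Set.mem_univ _))
  -- The inequality `ε ≤ g` written as an equation in the semiring, which `φ` transports to `r * ε ≤
  -- φ g`.
  have h1 : const ε + g = g := ext_finite fun x _ => by
    rw [add_apply, const_apply]
    exact max_eq_right (hε'.le.trans (hx₀ (Set.mem_univ x)))
  have h2 := congrArg (fun f => φ f) h1
  simp only [map_add, hφ] at h2
  have h3 : max ((r * ε : ℝ) : EReal) (φ g y) = φ g y := by
    conv_rhs => rw [← h2]
    rfl
  have h4 : ((r * ε : ℝ) : EReal) ≤ 0 := (max_eq_right_iff.1 h3).trans hg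
  have h5 : r * ε ≤ 0 := by exact_mod_cast h4
  have h6 : 0 < ε := by exact_mod_cast hε
  exact absurd h5 (not_le.2 (mul_pos hr h6))

/-- The semiring isomorphism `φ` is given by `f ↦ r • f ∘ Ψ⁻¹`. -/
structure IsInduced (φ : Γ₁.RatFun ≃+* Γ₂.RatFun) (r : ℝ) (Ψ : Γ₁.Point → Γ₂.Point) : Prop where
  pos : 0 < r
  apply_eq : ∀ f x, φ f (Ψ x) = (r : EReal) * f x

/-- Applying `exists_point` to `φ.symm` gives the map in the direction from `Γ₁` to `Γ₂`. -/
theorem exists_isInduced (φ : Γ₁.RatFun ≃+* Γ₂.RatFun) : ∃ r Ψ, IsInduced φ r Ψ := by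
  obtain ⟨r, hr, hφ⟩ := exists_factor φ
  have hφ' : ∀ a, φ.symm (const a) = const (r⁻¹ * a) := fun a => by
    rw [RingEquiv.symm_apply_eq, hφ, mul_inv_cancel_left₀ hr.ne']
  choose Ψ hΨ using exists_point (inv_pos.2 hr) hφ'
  refine ⟨r, Ψ, hr, fun f x => ?_⟩
  have := hΨ x (φ f)
  rw [RingEquiv.symm_apply_apply] at this
  rw [this, mul_inv_cancel_coe hr.ne']

namespace IsInduced

variable {φ : Γ₁.RatFun ≃+* Γ₂.RatFun} {r : ℝ} {Ψ : Γ₁.Point → Γ₂.Point}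

theorem factor_unique {r' : ℝ} {Ψ' : Γ₁.Point → Γ₂.Point} (h : IsInduced φ r Ψ)
    (h' : IsInduced φ r' Ψ') : r = r' := by
  obtain ⟨s, -, hs⟩ := exists_factor φ
  obtain ⟨x, -⟩ := exists_notMem_infinitePoints Γ₁
  -- `const 1` has the real value `1`, so it detects the factor. The unit of the semiring has value
  -- `0` and would not.
  have h1 := h.apply_eq (const 1) x
  have h2 := h'.apply_eq (const 1) x
  rw [hs, const_apply, const_apply, ← EReal.coe_mul, EReal.coe_eq_coe_iff] at h1 h2
  linarith

theorem unique {r' : ℝ} {Ψ' : Γ₁.Point → Γ₂.Point} (h : IsInduced φ r Ψ)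
    (h' : IsInduced φ r' Ψ') : Ψ = Ψ' := by
  obtain rfl := h.factor_unique h'
  funext x
  refine separates fun f => ?_
  obtain ⟨g, rfl⟩ := φ.surjective f
  rw [h.apply_eq, h'.apply_eq]

theorem injective (h : IsInduced φ r Ψ) : Function.Injective Ψ := by
  intro x x' hx
  refine separates fun f => coe_mul_injective h.pos.ne' ?_
  change (r : EReal) * f x = r * f x'
  rw [← h.apply_eq, ← h.apply_eq, hx]

theorem surjective (h : IsInduced φ r Ψ) : Function.Surjective Ψ := by
  obtain ⟨s, hs, hs'⟩ := exists_factor φ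
  have hrs : s = r := by
    obtain ⟨x, -⟩ := exists_notMem_infinitePoints Γ₁
    have h1 := h.apply_eq (const 1) x
    rw [hs', const_apply, const_apply, ← EReal.coe_mul, EReal.coe_eq_coe_iff] at h1
    linarith
  subst hrs
  intro y
  obtain ⟨x, hx⟩ := exists_point hs hs' y
  refine ⟨x, separates fun f => ?_⟩
  obtain ⟨g, rfl⟩ := φ.surjective f
  rw [h.apply_eq, hx]

theorem continuous (h : IsInduced φ r Ψ) : Continuous Ψ := by
  refine continuous_of_ratFun fun f => ?_
  obtain ⟨g, rfl⟩ := φ.surjective f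
  simp only [h.apply_eq]
  exact (continuous_coe_mul r).comp g.2.1

theorem symm (h : IsInduced φ r Ψ) {Ψ' : Γ₂.Point → Γ₁.Point} (hΨ' : ∀ y, Ψ (Ψ' y) = y) :
    IsInduced φ.symm r⁻¹ Ψ' := by
  refine ⟨inv_pos.2 h.pos, fun f y => ?_⟩
  obtain ⟨g, rfl⟩ := φ.surjective f
  rw [RingEquiv.symm_apply_apply]
  conv_rhs => rw [← hΨ' y]
  rw [h.apply_eq, inv_mul_cancel_coe h.pos.ne']

theorem mem_infinitePoints (h : IsInduced φ r Ψ) (x : Γ₁.Point) :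
    Ψ x ∈ Γ₂.infinitePoints ↔ x ∈ Γ₁.infinitePoints := by
  rw [mem_infinitePoints_iff, mem_infinitePoints_iff]
  have htop : (r : EReal) * ⊤ = ⊤ := EReal.coe_mul_top_of_pos h.pos
  constructor
  · rintro ⟨f, hf, hf'⟩
    obtain ⟨g, rfl⟩ := φ.surjective f
    refine ⟨g, fun h0 => hf (by rw [h0, map_zero]), ?_⟩
    rw [h.apply_eq] at hf'
    exact coe_mul_injective h.pos.ne' (hf'.trans htop.symm)
  · rintro ⟨f, hf, hf'⟩
    exact ⟨φ f, map_ne_zero_of_equiv φ hf, by rw [h.apply_eq, hf', htop]⟩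

end IsInduced

end TropicalCurve

namespace TropicalCurve

variable {Γ Γ₁ Γ₂ : TropicalCurve.{u}}

open RatFun

/-! ### Neighbourhoods of points inside the edges -/

theorem map_nhds_edgePoint {e : Γ.E} {t : Γ.Seg e} (ht : t.IsInner) :
    Filter.map (Γ.edgePoint e) (𝓝 t) = 𝓝 (Γ.edgePoint e t) :=
  le_antisymm (continuous_edgePoint e).continuousAt
    (Filter.le_map fun _ hN => image_edgePoint_mem_nhds ht hN)

/-- A homeomorphism takes neighbourhoods inside an edge to neighbourhoods inside an edge. -/
theorem eventually_homeomorph_edgePoint (Ψ : Γ₁.Point ≃ₜ Γ₂.Point) {e : Γ₁.E} {t : Γ₁.Seg e}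
    (ht : t.IsInner) {e' : Γ₂.E} {t' : Γ₂.Seg e'} (ht' : t'.IsInner)
    (h : Ψ (Γ₁.edgePoint e t) = Γ₂.edgePoint e' t') {p : Γ₂.Point → Prop} :
    (∀ᶠ s in 𝓝 t, p (Ψ (Γ₁.edgePoint e s))) ↔ ∀ᶠ s in 𝓝 t', p (Γ₂.edgePoint e' s) := by
  have h1 : Filter.map (fun s => Ψ (Γ₁.edgePoint e s)) (𝓝 t) =
      Filter.map (Γ₂.edgePoint e') (𝓝 t') := by
    rw [map_nhds_edgePoint ht', ← h, ← Ψ.map_nhds_eq, ← map_nhds_edgePoint ht, Filter.map_map]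
    rfl
  exact Filter.ext_iff.1 h1 {z | p z}

/-- Outside a finite set, a rational function is affine near the points of the curve. -/
theorem exists_finite_isAffineAt {f : Γ.RatFun} (hf : f ≠ 0) :
    ∃ B : Set Γ.Point, B.Finite ∧ (∀ v, Γ.vertexPoint v ∈ B) ∧
      ∀ e (t : Γ.Seg e), t.IsInner → Γ.edgePoint e t ∉ B →
        ∃ k c, IsAffineAt (fun s => f (Γ.edgePoint e s)) t k c := by
  have := Γ.finite_E
  have := Γ.finite_V
  choose P hP hPf using fun e => (isPiecewiseAffine hf e).exists_isAffineAt
  refine ⟨Set.range Γ.vertexPoint ∪ ⋃ e, Γ.edgePoint e '' P e,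
    (Set.finite_range _).union (Set.finite_iUnion fun e => (hP e).image _),
    fun v => Or.inl ⟨v, rfl⟩, fun e t ht hB => ?_⟩
  refine hPf e t (fun h => hB (Or.inr ?_)) ht.ne_top
  exact Set.mem_iUnion.2 ⟨e, t, h, rfl⟩

theorem exists_inner_of_notMem {B : Set Γ.Point} (hB : ∀ v, Γ.vertexPoint v ∈ B) {x : Γ.Point}
    (hx : x ∉ B) : ∃ (e : Γ.E) (t : Γ.Seg e), t.IsInner ∧ x = Γ.edgePoint e t := by
  rcases exists_rep x with ⟨v, rfl⟩ | h
  · exact absurd (hB v) hx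
  · exact h

theorem eventually_dist_eq_gap {e : Γ.E} {t : Γ.Seg e} (ht : t.IsInner) :
    ∀ᶠ p : Γ.Seg e × Γ.Seg e in 𝓝 (t, t),
      Γ.dist (Γ.edgePoint e p.1) (Γ.edgePoint e p.2) = gap p.1 p.2 := by
  have c1 : Continuous fun p : Γ.Seg e × Γ.Seg e => (p.1 : ℝ≥0∞) :=
    continuous_subtype_val.comp continuous_fst
  have c2 : Continuous fun p : Γ.Seg e × Γ.Seg e => (p.2 : ℝ≥0∞) :=
    continuous_subtype_val.comp continuous_snd
  have c3 : Continuous fun p : Γ.Seg e × Γ.Seg e => (2 * p.1 : ℝ≥0∞) :=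
    (ENNReal.continuous_const_mul (by simp)).comp c1
  have h1 : ∀ᶠ p : Γ.Seg e × Γ.Seg e in 𝓝 (t, t), (p.2 : ℝ≥0∞) < 2 * p.1 := by
    refine (isOpen_lt c2 c3).mem_nhds ?_
    change (t : ℝ≥0∞) < 2 * t
    rw [two_mul]
    exact ENNReal.lt_add_right ht.ne_top ht.1.ne'
  have h2 : ∀ᶠ p : Γ.Seg e × Γ.Seg e in 𝓝 (t, t), (2 * p.1 : ℝ≥0∞) < Γ.len e + p.2 := by
    refine (isOpen_lt c3 (continuous_const.add c2)).mem_nhds ?_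
    change (2 * t : ℝ≥0∞) < Γ.len e + t
    rw [two_mul]
    exact (ENNReal.add_lt_add_iff_right ht.ne_top).2 ht.2
  have h3 : ∀ᶠ p : Γ.Seg e × Γ.Seg e in 𝓝 (t, t), p.2.IsInner :=
    (continuous_snd.tendsto (t, t)).eventually (Seg.eventually_isInner ht)
  filter_upwards [h1, h2, h3] with p h1 h2 h3
  exact dist_edgePoint_eq_gap h3 h1.le h2.le

/-- The condition `σ * σ = 1` encodes a sign. The point `t₀` is excluded because the distance from
`t₀` has a kink there. -/
theorem isAffineAt_gap {e : Γ.E} {t t₀ : Γ.Seg e} (ht : (t : ℝ≥0∞) ≠ ⊤) (ht₀ : (t₀ : ℝ≥0∞) ≠ ⊤)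
    (hne : t ≠ t₀) : ∃ (σ : ℤ) (c : ℝ), σ * σ = 1 ∧
      IsAffineAt (fun s : Γ.Seg e => ((gap s t₀ : ℝ≥0∞) : EReal)) t σ c := by
  rcases lt_or_gt_of_ne hne with h | h
  · refine ⟨-1, (t₀ : ℝ≥0∞).toReal, by norm_num, ?_⟩
    filter_upwards [gt_mem_nhds h, Seg.eventually_ne_top ht] with s hs hs'
    rw [coe_ennreal_eq_coe_toReal (gap_ne_top hs' ht₀), toReal_gap hs' ht₀, abs_sub_comm,
      abs_of_nonneg (sub_nonneg.2 (ENNReal.toReal_mono ht₀ hs.le))]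
    congr 1
    push_cast
    ring
  · refine ⟨1, -(t₀ : ℝ≥0∞).toReal, by norm_num, ?_⟩
    filter_upwards [lt_mem_nhds h, Seg.eventually_ne_top ht] with s hs hs'
    rw [coe_ennreal_eq_coe_toReal (gap_ne_top hs' ht₀), toReal_gap hs' ht₀,
      abs_of_nonneg (sub_nonneg.2 (ENNReal.toReal_mono hs' hs.le))]
    congr 1
    push_cast
    ring

/-- The slopes of the distance from a point are at most `1`. -/
theorem abs_slope_dist_le_one {e : Γ.E} {t : Γ.Seg e} (ht : (t : ℝ≥0∞) ≠ ⊤) {y : Γ.Point}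
    (hy : y ∉ Γ.infinitePoints) {k : ℤ} {c : ℝ}
    (h : IsAffineAt (fun s => distFun y hy (Γ.edgePoint e s)) t k c) : |(k : ℝ)| ≤ 1 := by
  obtain ⟨s, ⟨hs, hs'⟩, hst⟩ := (((h.and (Seg.eventually_ne_top ht)).filter_mono
    (nhdsWithin_le_nhds (s := {t}ᶜ))).and self_mem_nhdsWithin).exists
  have hst' : 0 < |(s : ℝ≥0∞).toReal - (t : ℝ≥0∞).toReal| :=
    abs_pos.2 fun h0 => hst (Seg.toReal_injOn hs' ht (sub_eq_zero.1 h0))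
  have hfin : ∀ t : Γ.Seg e, (t : ℝ≥0∞) ≠ ⊤ → Γ.dist (Γ.edgePoint e t) y ≠ ⊤ := fun t ht =>
    dist_ne_top (mt edgePoint_mem_infinitePoints.1 ht) hy
  have hval : ∀ t : Γ.Seg e, (t : ℝ≥0∞) ≠ ⊤ →
      distFun y hy (Γ.edgePoint e t) = ((c + k * (t : ℝ≥0∞).toReal : ℝ) : EReal) →
      (Γ.dist (Γ.edgePoint e t) y).toReal = c + k * (t : ℝ≥0∞).toReal := by
    intro t ht h
    rw [distFun_apply, coe_ennreal_eq_coe_toReal (hfin t ht), EReal.coe_eq_coe_iff] at h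
    exact h
  have h1 := hval s hs' hs
  have h2 := hval t ht h.self_of_nhds
  have hle : ∀ s t : Γ.Seg e, (s : ℝ≥0∞) ≠ ⊤ → (t : ℝ≥0∞) ≠ ⊤ →
      (Γ.dist (Γ.edgePoint e s) y).toReal ≤
        |(s : ℝ≥0∞).toReal - (t : ℝ≥0∞).toReal| + (Γ.dist (Γ.edgePoint e t) y).toReal := by
    intro s t hs ht
    rw [← toReal_gap hs ht, ← ENNReal.toReal_add (gap_ne_top hs ht) (hfin t ht)]
    exact ENNReal.toReal_mono (ENNReal.add_ne_top.2 ⟨gap_ne_top hs ht, hfin t ht⟩)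
      (dist_edgePoint_le_add e s t y)
  have h3 := hle s t hs' ht
  have h4 := hle t s ht hs'
  rw [abs_sub_comm] at h4
  have h5 : |(k : ℝ) * ((s : ℝ≥0∞).toReal - (t : ℝ≥0∞).toReal)| ≤
      |(s : ℝ≥0∞).toReal - (t : ℝ≥0∞).toReal| := by
    rw [h1, h2] at h3 h4
    exact abs_le.2 ⟨by linarith, by linarith⟩
  rw [abs_mul] at h5
  exact le_of_mul_le_mul_right (by rwa [one_mul]) hst'

namespace IsInduced

variable {φ : Γ₁.RatFun ≃+* Γ₂.RatFun} {r : ℝ}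

/-- If `φ f` has slopes at most `1`, then so does `f`. -/
theorem abs_slope_le_one {Ψ : Γ₁.Point ≃ₜ Γ₂.Point} (h : IsInduced φ r Ψ) {f : Γ₁.RatFun}
    (hf : f ≠ 0)
    (hslope : ∀ e (t : Γ₂.Seg e), t.IsInner → ∀ (k : ℤ) (c : ℝ),
      IsAffineAt (fun s => φ f (Γ₂.edgePoint e s)) t k c → |(k : ℝ)| ≤ 1)
    {e : Γ₁.E} {t₀ : Γ₁.Seg e} (ht₀ : t₀.IsInner) {k : ℤ} {c : ℝ}
    (hk : IsAffineAt (fun s => f (Γ₁.edgePoint e s)) t₀ k c) : |(k : ℝ)| ≤ 1 := by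
  have hx₀ : Γ₁.edgePoint e t₀ ∉ Γ₁.infinitePoints := mt edgePoint_mem_infinitePoints.1 ht₀.ne_top
  -- the distance from `t₀` has slopes `1` and `-1` near `t₀`
  let T : Γ₁.RatFun := distFun _ hx₀
  have hT0 : T ≠ 0 := by
    intro h0
    have : T (Γ₁.edgePoint e t₀) = ⊥ := by rw [h0, zero_apply]
    rw [distFun_apply, dist_self] at this
    exact EReal.coe_ennreal_ne_bot _ this
  have hT : ∀ᶠ s in 𝓝 t₀, T (Γ₁.edgePoint e s) = ((gap s t₀ : ℝ≥0∞) : EReal) := by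
    have h1 : Filter.Tendsto (fun s : Γ₁.Seg e => (s, t₀)) (𝓝 t₀) (𝓝 (t₀, t₀)) :=
      (Continuous.prodMk_left t₀).tendsto t₀
    filter_upwards [h1.eventually (eventually_dist_eq_gap ht₀)] with s hs
    rw [distFun_apply, hs]
  obtain ⟨B, hB, hBv, hBf⟩ := exists_finite_isAffineAt (map_ne_zero_of_equiv φ hf)
  obtain ⟨C, hC, -, hCT⟩ := exists_finite_isAffineAt (map_ne_zero_of_equiv φ hT0)
  have hfin : ((fun s => Ψ (Γ₁.edgePoint e s)) ⁻¹' (B ∪ C)).Finite :=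
    finite_preimage_edgePoint e ((hB.union hC).preimage Ψ.injective.injOn)
  -- The point `t` is so close to `t₀` that the local formulas still hold, but it avoids the kink of
  -- `T`, and its image avoids the vertices and the breakpoints of `φ f` and `φ T`.
  obtain ⟨t, ⟨⟨htk, htT, hti⟩, htB⟩, htne⟩ := ((((hk.eventually_nhds.and (hT.eventually_nhds.and
    (Seg.eventually_isInner ht₀))).filter_mono nhdsWithin_le_nhds).and
    (Seg.eventually_notMem t₀ hfin)).and self_mem_nhdsWithin).exists
  obtain ⟨σ, d, hσ, hσd⟩ := isAffineAt_gap hti.ne_top ht₀.ne_top htne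
  have hTt : IsAffineAt (fun s => T (Γ₁.edgePoint e s)) t σ d := by
    filter_upwards [htT, hσd] with s h1 h2
    rw [h1, h2]
  obtain ⟨e', t', ht', hx⟩ := exists_inner_of_notMem hBv (fun hm => htB (Or.inl hm))
  obtain ⟨k₁, c₁, hk₁⟩ := hBf e' t' ht' (fun hm => htB (Or.inl (hx ▸ hm)))
  obtain ⟨m, c₂, hm⟩ := hCT e' t' ht' (fun hm => htB (Or.inr (hx ▸ hm)))
  have hσ0 : (σ : ℝ) * σ = 1 := by exact_mod_cast hσ
  -- near `t`, the function `f` is an affine function of `T`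
  have hfT : ∀ᶠ s in 𝓝 t, (φ f (Ψ (Γ₁.edgePoint e s))).toReal =
      r * (c - k * σ * d) + k * σ * (φ T (Ψ (Γ₁.edgePoint e s))).toReal := by
    filter_upwards [htk, hTt] with s h1 h2
    rw [h.apply_eq, h.apply_eq, h1, h2, ← EReal.coe_mul, ← EReal.coe_mul, EReal.toReal_coe,
      EReal.toReal_coe]
    linear_combination (-(r * k * (s : ℝ≥0∞).toReal)) * hσ0
  have hfT' := (eventually_homeomorph_edgePoint Ψ hti ht' hx
    (p := fun z => (φ f z).toReal = r * (c - k * σ * d) + k * σ * (φ T z).toReal)).1 hfT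
  have key := eq_of_eventually_affine_eq (k := k₁) (c := c₁) (k' := k * σ * m)
    (c' := r * (c - k * σ * d) + k * σ * c₂) ht'.ne_top (by
      filter_upwards [hfT', hk₁, hm] with s h1 h2 h3
      rw [h2, h3, EReal.toReal_coe, EReal.toReal_coe] at h1
      rw [h1]
      ring)
  -- If `m` were zero, `φ T` and hence `T` would be constant near the point, but `T` has slope `σ =
  -- ± 1` there.
  have hm0 : m ≠ 0 := by
    rintro rfl
    have h1 := (eventually_homeomorph_edgePoint Ψ hti ht' hx
      (p := fun z => (φ T z).toReal = c₂)).2 (by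
        filter_upwards [hm] with s hs
        rw [hs, EReal.toReal_coe]
        simp)
    have h2 := eq_of_eventually_affine_eq (k := r * σ) (c := r * d) (k' := 0) (c' := c₂)
      hti.ne_top (by
        filter_upwards [h1, hTt] with s h1 h2
        rw [h.apply_eq, h2, ← EReal.coe_mul, EReal.toReal_coe] at h1
        rw [← h1]
        ring)
    rcases mul_eq_zero.1 h2.1 with h3 | h3
    · exact h.pos.ne' h3
    · rw [h3] at hσ0
      simp at hσ0
  have h1 := hslope e' t' ht' k₁ c₁ hk₁
  rw [key.1, abs_mul, abs_mul] at h1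
  have hσ1 : |(σ : ℝ)| = 1 := by
    rw [← abs_mul_abs_self] at hσ0
    nlinarith [abs_nonneg (σ : ℝ)]
  have hm1 : 1 ≤ |(m : ℝ)| := by exact_mod_cast Int.one_le_abs hm0
  rw [hσ1, mul_one] at h1
  nlinarith [abs_nonneg (k : ℝ)]

/-- The preimage `f` of the distance from `Ψ y` is `r⁻¹ * dist (Ψ x) (Ψ y)` as a function of `x`.
Its slopes are at most `1` by `abs_slope_le_one`, so it is `1`-Lipschitz and vanishes at `y`. -/
theorem dist_le {Ψ : Γ₁.Point ≃ₜ Γ₂.Point} (h : IsInduced φ r Ψ) (x : Γ₁.Point) {y : Γ₁.Point}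
    (hy : y ∉ Γ₁.infinitePoints) :
    Γ₂.dist (Ψ x) (Ψ y) ≤ ENNReal.ofReal r * Γ₁.dist x y := by
  have hy' : Ψ y ∉ Γ₂.infinitePoints := mt (h.mem_infinitePoints y).1 hy
  obtain ⟨f, hf⟩ := φ.surjective (distFun _ hy')
  have hf0 : f ≠ 0 := by
    rintro rfl
    have : φ 0 (Ψ y) = ⊥ := by rw [map_zero, zero_apply]
    rw [hf, distFun_apply, dist_self] at this
    exact EReal.coe_ennreal_ne_bot _ this
  have hr0 : ENNReal.ofReal r ≠ 0 := by simpa using h.pos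
  have hrtop : ENNReal.ofReal r ≠ ⊤ := ENNReal.ofReal_ne_top
  have hg : ∀ x, x ∉ Γ₁.infinitePoints →
      (ENNReal.ofReal r)⁻¹ * Γ₂.dist (Ψ x) (Ψ y) = ENNReal.ofReal (f x).toReal := by
    intro x hx
    have h1 := h.apply_eq f x
    have hd : Γ₂.dist (Ψ x) (Ψ y) ≠ ⊤ := dist_ne_top (mt (h.mem_infinitePoints x).1 hx) hy'
    rw [hf, distFun_apply, coe_ennreal_eq_coe_toReal hd, ← coe_toReal_apply hf0 hx,
      ← EReal.coe_mul, EReal.coe_eq_coe_iff] at h1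
    rw [← ENNReal.ofReal_toReal hd, h1, ENNReal.ofReal_mul h.pos.le, ← mul_assoc,
      ENNReal.inv_mul_cancel hr0 hrtop, one_mul]
  have hlip := le_dist_add (g := fun x => (ENNReal.ofReal r)⁻¹ * Γ₂.dist (Ψ x) (Ψ y))
    (fun e s t => ?_) x y
  · rw [dist_self, mul_zero, add_zero] at hlip
    calc Γ₂.dist (Ψ x) (Ψ y)
        = ENNReal.ofReal r * ((ENNReal.ofReal r)⁻¹ * Γ₂.dist (Ψ x) (Ψ y)) := by
          rw [← mul_assoc, ENNReal.mul_inv_cancel hr0 hrtop, one_mul]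
      _ ≤ _ := mul_le_mul_right hlip _
  -- If `s ≠ t` and one of them is `∞`, then `gap s t = ∞` and nothing has to be shown.
  · by_cases hst : s = t
    · rw [hst]
      exact le_add_self
    by_cases hs : (s : ℝ≥0∞) = ⊤
    · have ht : (t : ℝ≥0∞) ≠ ⊤ := fun ht => hst (Subtype.ext (hs.trans ht.symm))
      rw [hs, gap_top ht, top_add]
      exact le_top
    by_cases ht : (t : ℝ≥0∞) = ⊤
    · rw [ht, gap_comm, gap_top hs, top_add]
      exact le_top
    have hfin : ∀ t : Γ₁.Seg e, (t : ℝ≥0∞) ≠ ⊤ → Γ₁.edgePoint e t ∉ Γ₁.infinitePoints :=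
      fun t ht => mt edgePoint_mem_infinitePoints.1 ht
    change (ENNReal.ofReal r)⁻¹ * Γ₂.dist (Ψ (Γ₁.edgePoint e s)) (Ψ y) ≤
      gap s t + (ENNReal.ofReal r)⁻¹ * Γ₂.dist (Ψ (Γ₁.edgePoint e t)) (Ψ y)
    rw [hg _ (hfin s hs), hg _ (hfin t ht), gap_eq_ofReal hs ht]
    obtain ⟨P, hP, hPf⟩ := (RatFun.isPiecewiseAffine hf0 e).exists_isAffineAt
    have key := abs_sub_le_of_isAffineAt (u := fun s => f (Γ₁.edgePoint e s)) (K := 1)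
      (f.2.1.comp (continuous_edgePoint e)) (fun t ht => ne_bot_ne_top hf0 (hfin t ht)) hP
      (fun t htP hti => by
        obtain ⟨k, c, hk⟩ := hPf t htP hti.ne_top
        refine ⟨k, c, h.abs_slope_le_one hf0 (fun e' t' ht' k' c' hk' => ?_) hti hk, hk⟩
        rw [hf] at hk'
        exact abs_slope_dist_le_one ht'.ne_top hy' hk') hs ht
    rw [one_mul] at key
    refine (ENNReal.ofReal_le_ofReal ?_).trans ENNReal.ofReal_add_le
    linarith [(abs_le.1 key).2]

end IsInduced

/-! ### Rational functions under expansive maps -/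

/-- A map between subsets of the line that scales distances is affine. The image of one point `j`
with `a j ≠ a i₀` fixes the sign, and the distances to `i₀` and `j` determine all other images. If
the scaled differences all vanish, any sign works. -/
theorem exists_sign_of_abs_eq {ι : Type*} {a b : ι → ℝ} {q : ℝ} (i₀ : ι)
    (h : ∀ i j, |b i - b j| = q * |a i - a j|) :
    ∃ σ : ℤ, (σ = 1 ∨ σ = -1) ∧ ∀ i, b i - b i₀ = σ * (q * (a i - a i₀)) := by
  have hsq : ∀ i j, (b i - b j) ^ 2 = (q * (a i - a j)) ^ 2 := by
    intro i j
    rw [← sq_abs, h, mul_pow, sq_abs, mul_pow]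
  by_cases hcon : ∃ i, q * (a i - a i₀) ≠ 0
  · obtain ⟨j, hj⟩ := hcon
    have hj' : ∃ σ : ℤ, (σ = 1 ∨ σ = -1) ∧ b j - b i₀ = σ * (q * (a j - a i₀)) := by
      rcases sq_eq_sq_iff_eq_or_eq_neg.1 (hsq j i₀) with h1 | h1
      · exact ⟨1, Or.inl rfl, by simpa using h1⟩
      · exact ⟨-1, Or.inr rfl, by simpa using h1⟩
    obtain ⟨σ, hσ, hσj⟩ := hj'
    refine ⟨σ, hσ, fun i => ?_⟩
    have h1 := hsq i i₀
    have h2 := hsq i j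
    have hσ2 : (σ : ℝ) * σ = 1 := by rcases hσ with rfl | rfl <;> norm_num
    apply mul_left_cancel₀ hj
    have h3 : (b i - b j) ^ 2 = ((b i - b i₀) - σ * (q * (a j - a i₀))) ^ 2 := by
      rw [← hσj]
      ring
    have h4 : (b i - b i₀) * (σ * (q * (a j - a i₀))) =
        (q * (a i - a i₀)) * (q * (a j - a i₀)) := by
      linear_combination (-1 / 2) * h2 + (1 / 2) * h3 + (1 / 2) * h1
        + (1 / 2) * (q * (a j - a i₀)) ^ 2 * hσ2
    linear_combination σ * h4 - (b i - b i₀) * (q * (a j - a i₀)) * hσ2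
  · push Not at hcon
    refine ⟨1, Or.inl rfl, fun i => ?_⟩
    have h1 := hsq i i₀
    rw [hcon i] at h1 ⊢
    simpa using h1

/-- Near inner points distances are differences of coordinates on both curves, so `χ` is affine with
slope `± q` in coordinates. The factor `q⁻¹` cancels `q`, and the slope of the composite is the
integer `± k`. -/
theorem isAffineAt_comp_expansive {χ : Γ₁.Point ≃ₜ Γ₂.Point} {q : ℝ≥0} (hq : 0 < q)
    (hχ : IsExpansive q χ) {f : Γ₂.RatFun} {e : Γ₁.E} {t₀ : Γ₁.Seg e} (ht₀ : t₀.IsInner)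
    {e' : Γ₂.E} {s₀ : Γ₂.Seg e'} (hs₀ : s₀.IsInner)
    (hx : χ (Γ₁.edgePoint e t₀) = Γ₂.edgePoint e' s₀) {k : ℤ} {c : ℝ}
    (hk : IsAffineAt (fun s => f (Γ₂.edgePoint e' s)) s₀ k c) :
    ∃ m d, IsAffineAt
      (fun t => (((q : ℝ)⁻¹ : ℝ) : EReal) * f (χ (Γ₁.edgePoint e t))) t₀ m d := by
  have hs₀d := eventually_dist_eq_gap hs₀
  rw [nhds_prod_eq] at hs₀d
  obtain ⟨J, hJ, hJd⟩ := Filter.eventually_prod_self_iff'.1 hs₀d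
  have ht₀d := eventually_dist_eq_gap ht₀
  rw [nhds_prod_eq] at ht₀d
  obtain ⟨N, hN, hNd⟩ := Filter.eventually_prod_self_iff'.1 ht₀d
  have hev := (eventually_homeomorph_edgePoint χ ht₀ hs₀ hx (p := fun z => ∃ s : Γ₂.Seg e',
    z = Γ₂.edgePoint e' s ∧ s ∈ J ∧ s.IsInner ∧
      f (Γ₂.edgePoint e' s) = ((c + k * (s : ℝ≥0∞).toReal : ℝ) : EReal))).2 (by
    filter_upwards [hk, hJ, Seg.eventually_isInner hs₀] with s h1 h2 h3
    exact ⟨s, rfl, h2, h3, h1⟩)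
  let M : Set (Γ₁.Seg e) := {t | t ∈ N ∧ t.IsInner ∧ ∃ s : Γ₂.Seg e',
    χ (Γ₁.edgePoint e t) = Γ₂.edgePoint e' s ∧ s ∈ J ∧ s.IsInner ∧
      f (Γ₂.edgePoint e' s) = ((c + k * (s : ℝ≥0∞).toReal : ℝ) : EReal)}
  have hM : M ∈ 𝓝 t₀ := Filter.inter_mem hN (Filter.inter_mem (Seg.eventually_isInner ht₀) hev)
  -- `τ` is the map `χ` in edge coordinates.
  choose τ hτ hτJ hτi hτf using fun t : M => t.2.2.2
  have hdist : ∀ t t' : M, |(τ t : ℝ≥0∞).toReal - (τ t' : ℝ≥0∞).toReal| =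
      q * |((t : Γ₁.Seg e) : ℝ≥0∞).toReal - ((t' : Γ₁.Seg e) : ℝ≥0∞).toReal| := by
    intro t t'
    have h1 := hχ.dist_eq (Γ₁.edgePoint e t) (Γ₁.edgePoint e t')
      (mt edgePoint_mem_infinitePoints.1 t.2.2.1.ne_top)
      (mt edgePoint_mem_infinitePoints.1 t'.2.2.1.ne_top)
    rw [hτ, hτ, hJd _ (hτJ t) _ (hτJ t'), hNd _ t.2.1 _ t'.2.1] at h1
    have h2 := congrArg ENNReal.toReal h1
    rw [ENNReal.toReal_mul, toReal_gap t.2.2.1.ne_top t'.2.2.1.ne_top,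
      toReal_gap (hτi t).ne_top (hτi t').ne_top] at h2
    exact h2.symm
  let t₁ : M := ⟨t₀, mem_of_mem_nhds hM⟩
  obtain ⟨σ, -, hσ⟩ := exists_sign_of_abs_eq (a := fun t : M => ((t : Γ₁.Seg e) : ℝ≥0∞).toReal)
    (b := fun t : M => (τ t : ℝ≥0∞).toReal) t₁ hdist
  refine ⟨k * σ, (q : ℝ)⁻¹ * (c + k * (τ t₁ : ℝ≥0∞).toReal) - k * σ * (t₀ : ℝ≥0∞).toReal, ?_⟩
  filter_upwards [hM] with t ht
  have h1 := hσ ⟨t, ht⟩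
  have h2 : (τ ⟨t, ht⟩ : ℝ≥0∞).toReal = (τ t₁ : ℝ≥0∞).toReal +
      σ * (q * ((t : ℝ≥0∞).toReal - (t₀ : ℝ≥0∞).toReal)) := by
    rw [← h1]
    ring
  rw [hτ ⟨t, ht⟩, hτf ⟨t, ht⟩, ← EReal.coe_mul, h2]
  congr 1
  have hq' : (q : ℝ) ≠ 0 := by exact_mod_cast hq.ne'
  push_cast
  field_simp
  ring

theorem isRational_comp_expansive {χ : Γ₁.Point ≃ₜ Γ₂.Point} {q : ℝ≥0} (hq : 0 < q)
    (hχ : IsExpansive q χ) (f : Γ₂.RatFun) :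
    Γ₁.IsRational fun x => (((q : ℝ)⁻¹ : ℝ) : EReal) * f (χ x) := by
  have hq' : (0 : ℝ) < (q : ℝ)⁻¹ := by
    rw [inv_pos]
    exact_mod_cast hq
  refine ⟨(continuous_coe_mul _).comp (f.2.1.comp χ.continuous), ?_⟩
  by_cases hf : f = 0
  · left
    intro x
    change (((q : ℝ)⁻¹ : ℝ) : EReal) * f (χ x) = ⊥
    rw [hf, zero_apply, EReal.coe_mul_bot_of_pos hq']
  · refine Or.inr ⟨fun x hx => ?_, fun e => ?_⟩
    · change (((q : ℝ)⁻¹ : ℝ) : EReal) * f (χ x) ≠ ⊥ ∧ (((q : ℝ)⁻¹ : ℝ) : EReal) * f (χ x) ≠ ⊤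
      rw [← coe_toReal_apply hf (mt (hχ.mem_infinitePoints x).1 hx), ← EReal.coe_mul]
      exact ⟨EReal.coe_ne_bot _, EReal.coe_ne_top _⟩
    -- An inner point may be sent to a vertex of valence two. Since `B` contains the vertices as
    -- well as the breakpoints, such points are excluded.
    · obtain ⟨B, hB, hBv, hBf⟩ := exists_finite_isAffineAt hf
      have hfin : ((fun s => χ (Γ₁.edgePoint e s)) ⁻¹' B).Finite :=
        finite_preimage_edgePoint e (hB.preimage χ.injective.injOn)
      refine isPiecewiseAffine_of_isAffineAt (hfin.union (Seg.finite_not_isInner e))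
        fun t ht _ => ?_
      rw [Set.mem_union, not_or] at ht
      obtain ⟨e', s, hs, hx⟩ := exists_inner_of_notMem hBv ht.1
      obtain ⟨k, c, hk⟩ := hBf e' s hs (fun hm => ht.1 ((congrArg (· ∈ B) hx).mpr hm))
      exact isAffineAt_comp_expansive hq hχ (not_not.1 ht.2) hs hx hk

end TropicalCurve

namespace TropicalCurve

variable {Γ₁ Γ₂ Γ₃ : TropicalCurve.{u}}

open RatFun

/-! ### Semiring isomorphisms and expansive maps -/

/-- The two inequalities between the distances are `dist_le` for `φ` and for its inverse, which is
induced by `Ψ⁻¹` with factor `r⁻¹`. -/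
theorem isExpansive_of_isInduced {φ : Γ₁.RatFun ≃+* Γ₂.RatFun} {r : ℝ≥0}
    {Ψ : Γ₁.Point → Γ₂.Point} (h : IsInduced φ r Ψ) : IsExpansive r Ψ where
  continuous := h.continuous
  bijective := ⟨h.injective, h.surjective⟩
  mem_infinitePoints := h.mem_infinitePoints
  dist_eq x y hx hy := by
    let E : Γ₁.Point ≃ₜ Γ₂.Point := Continuous.homeoOfEquivCompactToT2
      (f := Equiv.ofBijective Ψ ⟨h.injective, h.surjective⟩) h.continuous
    have hE : IsInduced φ r E := h
    have hE' : IsInduced φ.symm (r : ℝ)⁻¹ E.symm := hE.symm E.apply_symm_apply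
    have hr : (0 : ℝ) < r := h.pos
    have hr0 : (r : ℝ≥0∞) ≠ 0 := by
      have : (0 : ℝ≥0) < r := by exact_mod_cast hr
      exact_mod_cast this.ne'
    have h1 := hE.dist_le x hy
    have h2 := hE'.dist_le (E x) (y := E y) (mt (hE.mem_infinitePoints y).1 hy)
    rw [E.symm_apply_apply, E.symm_apply_apply, ENNReal.ofReal_inv_of_pos hr,
      ENNReal.ofReal_coe_nnreal] at h2
    rw [ENNReal.ofReal_coe_nnreal] at h1
    refine le_antisymm ?_ h1
    calc (r : ℝ≥0∞) * Γ₁.dist x y ≤ r * ((r : ℝ≥0∞)⁻¹ * Γ₂.dist (E x) (E y)) :=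
          mul_le_mul_right h2 _
      _ = Γ₂.dist (E x) (E y) := by
          rw [← mul_assoc, ENNReal.mul_inv_cancel hr0 ENNReal.coe_ne_top, one_mul]

theorem IsExpansive.symm {r : ℝ≥0} (hr : 0 < r) {χ : Γ₁.Point ≃ₜ Γ₂.Point}
    (h : IsExpansive r χ) : IsExpansive r⁻¹ χ.symm where
  continuous := χ.symm.continuous
  bijective := χ.symm.bijective
  mem_infinitePoints y := by
    rw [← h.mem_infinitePoints, χ.apply_symm_apply]
  dist_eq x y hx hy := by
    have h1 := h.dist_eq (χ.symm x) (χ.symm y)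
      (by rwa [← h.mem_infinitePoints, χ.apply_symm_apply])
      (by rwa [← h.mem_infinitePoints, χ.apply_symm_apply])
    rw [χ.apply_symm_apply, χ.apply_symm_apply] at h1
    have hr0 : (r : ℝ≥0∞) ≠ 0 := by exact_mod_cast hr.ne'
    rw [← h1, ENNReal.coe_inv hr.ne', ← mul_assoc,
      ENNReal.inv_mul_cancel hr0 ENNReal.coe_ne_top, one_mul]

namespace RatFun

/-- The pullback of rational functions along an expansive map, divided by the factor. -/
noncomputable def pullback {χ : Γ₁.Point ≃ₜ Γ₂.Point} {q : ℝ≥0} (hq : 0 < q)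
    (hχ : IsExpansive q χ) (f : Γ₂.RatFun) : Γ₁.RatFun :=
  ⟨_, isRational_comp_expansive hq hχ f⟩

theorem pullback_apply {χ : Γ₁.Point ≃ₜ Γ₂.Point} {q : ℝ≥0} (hq : 0 < q)
    (hχ : IsExpansive q χ) (f : Γ₂.RatFun) (x : Γ₁.Point) :
    pullback hq hχ f x = (((q : ℝ)⁻¹ : ℝ) : EReal) * f (χ x) := rfl

theorem pullback_add {χ : Γ₁.Point ≃ₜ Γ₂.Point} {q : ℝ≥0} (hq : 0 < q)
    (hχ : IsExpansive q χ) (f g : Γ₂.RatFun) :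
    pullback hq hχ (f + g) = pullback hq hχ f + pullback hq hχ g := by
  refine ext_finite fun x _ => ?_
  rw [add_apply, pullback_apply, pullback_apply, pullback_apply, add_apply]
  refine Monotone.map_max (f := fun a : EReal => (((q : ℝ)⁻¹ : ℝ) : EReal) * a) fun a b hab => ?_
  exact mul_le_mul_of_nonneg_left hab (by exact_mod_cast inv_nonneg.2 q.2)

theorem pullback_mul {χ : Γ₁.Point ≃ₜ Γ₂.Point} {q : ℝ≥0} (hq : 0 < q)
    (hχ : IsExpansive q χ) (f g : Γ₂.RatFun) :
    pullback hq hχ (f * g) = pullback hq hχ f * pullback hq hχ g := by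
  refine ext_finite fun x hx => ?_
  rw [mul_apply _ _ hx, pullback_apply, pullback_apply, pullback_apply,
    mul_apply _ _ (mt (hχ.mem_infinitePoints x).1 hx)]
  exact EReal.left_distrib_of_nonneg_of_ne_top (by exact_mod_cast inv_nonneg.2 q.2)
    (EReal.coe_ne_top _) _ _

end RatFun

/-- The isomorphism is the pullback along `Ψ⁻¹`, an expansive map of factor `r⁻¹`. Dividing by that
factor multiplies the values by `r`. -/
theorem exists_isInduced_of_isExpansive {r : ℝ≥0} (hr : 0 < r) {Ψ : Γ₁.Point → Γ₂.Point}
    (h : IsExpansive r Ψ) : ∃ φ : Γ₁.RatFun ≃+* Γ₂.RatFun, IsInduced φ r Ψ := by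
  let E : Γ₁.Point ≃ₜ Γ₂.Point := Continuous.homeoOfEquivCompactToT2
    (f := Equiv.ofBijective Ψ h.bijective) h.continuous
  have hE : IsExpansive r E := h
  have hE' := hE.symm hr
  have hr' : 0 < r⁻¹ := inv_pos.2 hr
  have hr0 : (r : ℝ) ≠ 0 := by exact_mod_cast hr.ne'
  let φ : Γ₁.RatFun ≃+* Γ₂.RatFun :=
    { toFun := pullback hr' hE'
      invFun := pullback hr hE
      left_inv := fun f => ext_finite fun x _ => by
        rw [pullback_apply, pullback_apply, E.symm_apply_apply, NNReal.coe_inv, inv_inv,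
          inv_mul_cancel_coe hr0]
      right_inv := fun f => ext_finite fun x _ => by
        rw [pullback_apply, pullback_apply, E.apply_symm_apply, NNReal.coe_inv, inv_inv,
          mul_inv_cancel_coe hr0]
      map_mul' := pullback_mul hr' hE'
      map_add' := pullback_add hr' hE' }
  refine ⟨φ, by exact_mod_cast hr, fun f x => ?_⟩
  change pullback hr' hE' f (E x) = _
  rw [pullback_apply, E.symm_apply_apply, NNReal.coe_inv, inv_inv]

namespace IsInduced

theorem refl (Γ : TropicalCurve.{u}) : IsInduced (RingEquiv.refl Γ.RatFun) 1 (fun x => x) :=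
  ⟨one_pos, fun f x => by simp⟩

theorem trans {φ : Γ₁.RatFun ≃+* Γ₂.RatFun} {ψ : Γ₂.RatFun ≃+* Γ₃.RatFun} {r s : ℝ}
    {Φ : Γ₁.Point → Γ₂.Point} {Ψ : Γ₂.Point → Γ₃.Point} (h : IsInduced φ r Φ)
    (h' : IsInduced ψ s Ψ) : IsInduced (φ.trans ψ) (s * r) (fun x => Ψ (Φ x)) :=
  ⟨mul_pos h'.pos h.pos, fun f x => by
    rw [RingEquiv.trans_apply, h'.apply_eq, h.apply_eq, EReal.coe_mul, mul_assoc]⟩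

theorem equiv_unique {φ φ' : Γ₁.RatFun ≃+* Γ₂.RatFun} {r : ℝ} {Φ : Γ₁.Point → Γ₂.Point}
    (h : IsInduced φ r Φ) (h' : IsInduced φ' r Φ) : φ = φ' := by
  refine RingEquiv.ext fun f => ext_finite fun y _ => ?_
  obtain ⟨x, rfl⟩ := h.surjective y
  rw [h.apply_eq, h'.apply_eq]

end IsInduced

theorem ExpansiveMap.eq_of_isInduced {φ : Γ₁.RatFun ≃+* Γ₂.RatFun} {ψ ψ' : ExpansiveMap Γ₁ Γ₂}
    (h : IsInduced φ ψ.factor ψ.toFun) (h' : IsInduced φ ψ'.factor ψ'.toFun) : ψ = ψ' :=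
  ExpansiveMap.ext (NNReal.coe_injective (h.factor_unique h')) (h.unique h')

theorem exists_expansiveMap (φ : Γ₁.RatFun ≃+* Γ₂.RatFun) :
    ∃ ψ : ExpansiveMap Γ₁ Γ₂, IsInduced φ ψ.factor ψ.toFun := by
  obtain ⟨r, Ψ, h⟩ := exists_isInduced φ
  lift r to ℝ≥0 using h.pos.le
  exact ⟨⟨r, Ψ, by exact_mod_cast h.pos, isExpansive_of_isInduced h⟩, h⟩

/-- The expansive map that induces a semiring isomorphism. -/
noncomputable def expansiveMapOfRingEquiv (φ : Γ₁.RatFun ≃+* Γ₂.RatFun) : ExpansiveMap Γ₁ Γ₂ :=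
  (exists_expansiveMap φ).choose

theorem isInduced_expansiveMapOfRingEquiv (φ : Γ₁.RatFun ≃+* Γ₂.RatFun) :
    IsInduced φ (expansiveMapOfRingEquiv φ).factor (expansiveMapOfRingEquiv φ).toFun :=
  (exists_expansiveMap φ).choose_spec

/-- The semiring isomorphism induced by an expansive map. -/
noncomputable def ringEquivOfExpansiveMap (ψ : ExpansiveMap Γ₁ Γ₂) : Γ₁.RatFun ≃+* Γ₂.RatFun :=
  (exists_isInduced_of_isExpansive ψ.factor_pos ψ.isExpansive).choose

theorem isInduced_ringEquivOfExpansiveMap (ψ : ExpansiveMap Γ₁ Γ₂) :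
    IsInduced (ringEquivOfExpansiveMap ψ) ψ.factor ψ.toFun :=
  (exists_isInduced_of_isExpansive ψ.factor_pos ψ.isExpansive).choose_spec

/-! ### The expansion factor -/

/-- By connectedness a curve with two points has an edge. An inner point of it and its source are
finite and distinct. -/
theorem exists_finite_ne [Nontrivial Γ₁.Point] :
    ∃ x y : Γ₁.Point, x ∉ Γ₁.infinitePoints ∧ y ∉ Γ₁.infinitePoints ∧ x ≠ y := by
  have hE : Nonempty Γ₁.E := by
    by_contra hE
    rw [not_nonempty_iff] at hE
    obtain ⟨x, y, hxy⟩ := exists_pair_ne Γ₁.Point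
    rcases exists_rep x with ⟨v, rfl⟩ | ⟨e, -⟩
    · rcases exists_rep y with ⟨w, rfl⟩ | ⟨e, -⟩
      · have : ∀ a b, Relation.EqvGen (fun a b => ∃ e, Γ₁.src e = a ∧ Γ₁.tgt e = b) a b →
            a = b := by
          intro a b h
          induction h with
          | rel a b h => exact hE.elim h.choose
          | refl a => rfl
          | symm a b _ ih => exact ih.symm
          | trans a b c _ _ ih ih' => exact ih.trans ih'
        exact hxy (congrArg _ (this v w (Γ₁.connected v w)))
      · exact hE.elim e
    · exact hE.elim e
  obtain ⟨e⟩ := hE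
  obtain ⟨t, ht0, htl⟩ := exists_between (Γ₁.len_pos e)
  have hi : Seg.IsInner (⟨t, zero_le, htl.le⟩ : Γ₁.Seg e) := ⟨ht0, htl⟩
  exact ⟨_, _, mt edgePoint_mem_infinitePoints.1 hi.ne_top, vertexPoint_src_not_mem e,
    edgePoint_ne_vertexPoint hi _⟩

/-- The distance of two distinct finite points is neither `0` nor `∞`, so it cancels. On a one-point
curve all distances are `0` and the factor is arbitrary. -/
theorem ExpansiveMap.eq_of_toFun_eq [Nontrivial Γ₁.Point] {φ ψ : ExpansiveMap Γ₁ Γ₂}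
    (h : φ.toFun = ψ.toFun) : φ = ψ := by
  obtain ⟨x, y, hx, hy, hxy⟩ := exists_finite_ne (Γ₁ := Γ₁)
  refine ExpansiveMap.ext ?_ h
  have h1 := (φ.isExpansive.dist_eq x y hx hy).trans
    ((by rw [h]) : Γ₂.dist (φ.toFun x) (φ.toFun y) = Γ₂.dist (ψ.toFun x) (ψ.toFun y))
  rw [← ψ.isExpansive.dist_eq x y hx hy] at h1
  have h0 : Γ₁.dist x y ≠ 0 := fun h0 => hxy (eq_of_dist_eq_zero h0)
  exact_mod_cast (ENNReal.mul_left_inj h0 (dist_ne_top hx hy)).1 h1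

end TropicalCurve

/-! ### The isomorphism of categories -/

open CategoryTheory TropicalCurve

/-- A semiring isomorphism is sent to the expansive map that induces it. -/
noncomputable def ratToExp : RatCat.{u} ⥤ ExpCat.{u} where
  obj X := ⟨X.curve⟩
  map φ := expansiveMapOfRingEquiv φ
  map_id X := ExpansiveMap.eq_of_isInduced (isInduced_expansiveMapOfRingEquiv _)
    (IsInduced.refl X.curve)
  map_comp φ ψ := ExpansiveMap.eq_of_isInduced (isInduced_expansiveMapOfRingEquiv _)
    ((isInduced_expansiveMapOfRingEquiv φ).trans (isInduced_expansiveMapOfRingEquiv ψ))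

/-- An expansive map is sent to the semiring isomorphism that it induces. -/
noncomputable def expToRat : ExpCat.{u} ⥤ RatCat.{u} where
  obj X := ⟨X.curve⟩
  map ψ := ringEquivOfExpansiveMap ψ
  map_id X := IsInduced.equiv_unique (isInduced_ringEquivOfExpansiveMap _)
    (IsInduced.refl X.curve)
  map_comp φ ψ := IsInduced.equiv_unique (isInduced_ringEquivOfExpansiveMap _)
    ((isInduced_ringEquivOfExpansiveMap φ).trans (isInduced_ringEquivOfExpansiveMap ψ))

/-- The original isomorphism and the reconstructed one are induced by the same pair of factor and
map, hence equal. -/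
theorem ratToExp_comp_expToRat : ratToExp.{u} ⋙ expToRat.{u} = 𝟭 RatCat.{u} :=
  Functor.hext (fun _ => rfl) fun _ _ φ => heq_of_eq
    (IsInduced.equiv_unique (isInduced_ringEquivOfExpansiveMap (expansiveMapOfRingEquiv φ))
      (isInduced_expansiveMapOfRingEquiv φ))

theorem expToRat_comp_ratToExp : expToRat.{u} ⋙ ratToExp.{u} = 𝟭 ExpCat.{u} :=
  Functor.hext (fun _ => rfl) fun _ _ ψ => heq_of_eq
    (ExpansiveMap.eq_of_isInduced
      (isInduced_expansiveMapOfRingEquiv (ringEquivOfExpansiveMap ψ))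
      (isInduced_ringEquivOfExpansiveMap ψ))

theorem isGroupoid_ratCat : IsGroupoid RatCat.{u} where
  all_isIso {X Y} φ := ⟨(RingEquiv.symm φ : Y.curve.RatFun ≃+* X.curve.RatFun),
    RingEquiv.self_trans_symm φ, RingEquiv.symm_trans_self φ⟩

/-- Every expansive map is the image under `ratToExp` of a semiring isomorphism, and functors
preserve isomorphisms. -/
theorem isGroupoid_expCat : IsGroupoid ExpCat.{u} where
  all_isIso ψ := by
    have := isGroupoid_ratCat.{u}.all_isIso (expToRat.map ψ)
    have h : ratToExp.map (expToRat.map ψ) = ψ :=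
      ExpansiveMap.eq_of_isInduced
        (isInduced_expansiveMapOfRingEquiv (ringEquivOfExpansiveMap ψ))
        (isInduced_ringEquivOfExpansiveMap ψ)
    have h' := Functor.map_isIso ratToExp (expToRat.map ψ)
    rw [h] at h'
    exact h'

theorem corollary1 :
    CategoryTheory.IsGroupoid RatCat.{u} ∧
    CategoryTheory.IsGroupoid ExpCat.{u} ∧
    (∃ (F : CategoryTheory.Functor RatCat.{u} ExpCat.{u})
        (G : CategoryTheory.Functor ExpCat.{u} RatCat.{u}),
      F.comp G = CategoryTheory.Functor.id RatCat.{u} ∧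
      G.comp F = CategoryTheory.Functor.id ExpCat.{u} ∧
      (∀ X : RatCat.{u}, (F.obj X).curve = X.curve) ∧
      (∀ Y : ExpCat.{u}, (G.obj Y).curve = Y.curve)) ∧
    (∀ (Γ₁ Γ₂ : TropicalCurve.{u}), Nontrivial Γ₁.Point →
      ∀ φ ψ : TropicalCurve.ExpansiveMap Γ₁ Γ₂, φ.toFun = ψ.toFun → φ = ψ) :=
  ⟨isGroupoid_ratCat, isGroupoid_expCat,
    ⟨ratToExp, expToRat, ratToExp_comp_expToRat, expToRat_comp_ratToExp, fun _ => rfl,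
      fun _ => rfl⟩,
    fun _ _ _ _ _ h => ExpansiveMap.eq_of_toFun_eq h⟩
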